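/- Let $U\subseteq\mathbb R^4$ be open, with coordinates $(u,v,x,y)$, and consider on $U$ the Walker metric \[ ds^2 = 2\,du\,(dv+H_1\,du+W\,dx)+2\,dx\,(dy+H_2\,dx+W\,du), \] where \[ H_1=vH_1^{(1)}(u,x,y)+H_1^{(0)}(u,x,y),\quad H_2=vH_2^{(10)}(u,x)+yH_2^{(01)}(u,x)+H_2^{(0)}(u,x),\quad W=vW^{(1)}(u,x)+W^{(0)}(u,x,y) \] and all coefficient functions are smooth. A (scalar polynomial curvature) invariant of order at most $N$ is a linear combination of complete contractions, by means of the inverse metric, of tensor products of one or more factors taken from $R,\nabla R,\dots,\nabla^{N}R$, where $R$ is the Riemann tensor. The metric is VSI$_N$ if all invariants of order at most $N$ vanish on $U$, and VSI if this holds for every $N$. Consider the double null coframe $\omega^1=du$, $\omega^2=dv+H_1du+W\,dx$, $\omega^3=dx$, $\omega^4=dy+H_2dx+W\,du$ and its dual frame. The component of a covariant tensor with lower frame indices $a_1,\dots,a_k$ has boost weight $(b_1,b_2)$, $b_1=\#(2)-\#(1)$, $b_2=\#(4)-\#(3)$, where $\#(i)$ is the number of indices equal to $i$; thus it is multiplied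 by $e^{b_1\lambda_1+b_2\lambda_2}$ under $(\omega^1,\omega^2,\omega^3,\omega^4)\mapsto(e^{\lambda_1}\omega^1,e^{-\lambda_1}\omega^2,e^{\lambda_2}\omega^3,e^{-\lambda_2}\omega^4)$. A tensor has the $\mathbf N$-property if all its components with $b_1>0$, or with $b_1=0$ and $b_2\ge 0$, vanish on $U$. Then the metric is a smooth metric of neutral signature $(--++)$ on $U$, and: 1. If $H_2^{(10)}\neq0$ (that is, it does not vanish identically on $U$), then all invariants of order at most $1$ vanish, i.e. the metric is VSI$_1$; moreover $R$ and $\nabla R$ have the $\mathbf N$-property. 2. If $H_2^{(10)}=0$ on $U$, then all polynomial curvature invariants vanish, i.e. the metric is VSI; moreover $\nabla^kR$ has the $\mathbf N$-property for every $k\ge0$. -/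

import Mathlib

open scoped ContDiff

noncomputable section

namespace Walker

/-! Pseudo-Riemannian geometry in one coordinate chart. -/

/-- A covariant tensor field of rank `k` on (an open set of) `ℝⁿ`, given by its components in the
coordinate frame: `T I p` is the component with lower indices `I 0, …, I (k - 1)` at `p`. -/
abbrev CovTensor (n k : ℕ) : Type := (Fin k → Fin n) → (Fin n → ℝ) → ℝ

/-- The partial derivative `∂ᵢ f` at `p`. -/
def partialDeriv {n : ℕ} (i : Fin n) (f : (Fin n → ℝ) → ℝ) (p : Fin n → ℝ) : ℝ :=
  fderiv ℝ f p (Pi.single i 1)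

/-- The Christoffel symbol `Γˡᵢⱼ` of the Levi-Civita connection of `g`. -/
def christoffel {n : ℕ} (g : (Fin n → ℝ) → Matrix (Fin n) (Fin n) ℝ) (l i j : Fin n)
    (p : Fin n → ℝ) : ℝ :=
  (1 / 2 : ℝ) * ∑ m, (g p)⁻¹ l m *
    (partialDeriv i (fun q => g q j m) p + partialDeriv j (fun q => g q i m) p
      - partialDeriv m (fun q => g q i j) p)

/-- The components `Rᵉ_{bcd} = ∂_c Γᵉ_{db} - ∂_d Γᵉ_{cb} + Γᵉ_{cf} Γᶠ_{db} - Γᵉ_{df} Γᶠ_{cb}`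
of the curvature tensor. -/
def riemannUp {n : ℕ} (g : (Fin n → ℝ) → Matrix (Fin n) (Fin n) ℝ) (e b c d : Fin n)
    (p : Fin n → ℝ) : ℝ :=
  partialDeriv c (christoffel g e d b) p - partialDeriv d (christoffel g e c b) p
    + ∑ f, (christoffel g e c f p * christoffel g f d b p
      - christoffel g e d f p * christoffel g f c b p)

/-- The Riemann tensor `R_{abcd} = g_{ae} Rᵉ_{bcd}`. -/
def riemann {n : ℕ} (g : (Fin n → ℝ) → Matrix (Fin n) (Fin n) ℝ) : CovTensor n 4 :=
  fun I p => ∑ e, g p (I 0) e * riemannUp g e (I 1) (I 2) (I 3) p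

/-- The covariant derivative `∇T` of a covariant tensor field; the new index is the last one:
`(∇T)_{i₁…iₖ m} = ∂_m T_{i₁…iₖ} - ∑ₛ Γˡ_{m iₛ} T_{i₁…l…iₖ}`. -/
def covDeriv {n k : ℕ} (g : (Fin n → ℝ) → Matrix (Fin n) (Fin n) ℝ) (T : CovTensor n k) :
    CovTensor n (k + 1) :=
  fun I p =>
    partialDeriv (I (Fin.last k)) (T (fun s => I s.castSucc)) p
      - ∑ s : Fin k, ∑ l : Fin n, christoffel g l (I (Fin.last k)) (I s.castSucc) p
          * T (Function.update (fun s' : Fin k => I s'.castSucc) s l) p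

/-- The `k`-th covariant derivative `∇ᵏR` of the Riemann tensor. -/
def nablaRiemann {n : ℕ} (g : (Fin n → ℝ) → Matrix (Fin n) (Fin n) ℝ) :
    (k : ℕ) → CovTensor n (4 + k)
  | 0 => riemann g
  | k + 1 => covDeriv g (nablaRiemann g k)

/-- The index slots of the tensor product `∇^{k₁}R ⊗ ⋯ ⊗ ∇^{kₘ}R`. -/
abbrev Slot {m : ℕ} (ks : Fin m → ℕ) : Type := Σ i : Fin m, Fin (4 + ks i)

/-- The complete contraction of `∇^{k₁}R ⊗ ⋯ ⊗ ∇^{kₘ}R` with `r` copies of the inverse metric; `e`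
groups the index slots into `r` pairs, and the two indices in each pair are contracted. -/
def fullContraction {n m r : ℕ} (g : (Fin n → ℝ) → Matrix (Fin n) (Fin n) ℝ) (ks : Fin m → ℕ)
    (e : (Fin r ⊕ Fin r) ≃ Slot ks) (p : Fin n → ℝ) : ℝ :=
  ∑ I : Slot ks → Fin n,
    (∏ j : Fin r, (g p)⁻¹ (I (e (Sum.inl j))) (I (e (Sum.inr j))))
      * ∏ i : Fin m, nablaRiemann g (ks i) (fun s => I ⟨i, s⟩) p

/-- The scalar polynomial curvature invariants (without constant term) of `g` of order at most `N`:
the linear combinations of complete contractions of products of at least one factor, each factor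
being one of `R, ∇R, …, ∇ᴺR`. A product of complete contractions is one again. -/
def curvatureInvariants {n : ℕ} (g : (Fin n → ℝ) → Matrix (Fin n) (Fin n) ℝ) (N : ℕ) :
    Submodule ℝ ((Fin n → ℝ) → ℝ) :=
  Submodule.span ℝ {F | ∃ (m r : ℕ) (ks : Fin m → ℕ) (e : (Fin r ⊕ Fin r) ≃ Slot ks),
    0 < m ∧ (∀ i, ks i ≤ N) ∧ F = fullContraction g ks e}

/-- `g` is `VSI_N` on `U`: all polynomial curvature invariants of order at most `N` vanish. -/
def IsVSIOrder {n : ℕ} (g : (Fin n → ℝ) → Matrix (Fin n) (Fin n) ℝ) (U : Set (Fin n → ℝ))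
    (N : ℕ) : Prop :=
  ∀ F ∈ curvatureInvariants g N, ∀ p ∈ U, F p = 0

/-- `g` is `VSI` on `U`: all polynomial curvature invariants, of every order, vanish. -/
def IsVSI {n : ℕ} (g : (Fin n → ℝ) → Matrix (Fin n) (Fin n) ℝ) (U : Set (Fin n → ℝ)) : Prop :=
  ∀ N, IsVSIOrder g U N

/-- `g` is a smooth metric of neutral signature `(- - + +)` on `U`. -/
def IsNeutralMetricOn (g : (Fin 4 → ℝ) → Matrix (Fin 4) (Fin 4) ℝ) (U : Set (Fin 4 → ℝ)) : Prop :=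
  (∀ i j, ContDiffOn ℝ ∞ (fun p => g p i j) U) ∧
    ∀ p ∈ U, ∃ P : Matrix (Fin 4) (Fin 4) ℝ, IsUnit P.det ∧
      P.transpose * g p * P = Matrix.diagonal ![-1, -1, 1, 1]

/-! Walker metrics. The coordinates are `(u, v, x, y) = (p 0, p 1, p 2, p 3)`. -/

/-- The Walker metric `ds² = 2 du (dv + H₁ du + W dx) + 2 dx (dy + H₂ dx + W du)`. -/
def walkerMetric (H₁ H₂ W : (Fin 4 → ℝ) → ℝ) (p : Fin 4 → ℝ) : Matrix (Fin 4) (Fin 4) ℝ :=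
  !![2 * H₁ p, 1, 2 * W p, 0;
     1, 0, 0, 0;
     2 * W p, 0, 2 * H₂ p, 1;
     0, 0, 1, 0]

/-- The double null coframe `ω¹ = du`, `ω² = dv + H₁ du + W dx`, `ω³ = dx`,
`ω⁴ = dy + H₂ dx + W du`; row `a` holds the coordinate components of the `a`-th form. -/
def coframe (H₁ H₂ W : (Fin 4 → ℝ) → ℝ) (p : Fin 4 → ℝ) : Matrix (Fin 4) (Fin 4) ℝ :=
  !![1, 0, 0, 0;
     H₁ p, 1, W p, 0;
     0, 0, 1, 0;
     W p, 0, H₂ p, 1]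

/-- The frame dual to `coframe`: `e₁ = ∂ᵤ - H₁ ∂ᵥ - W ∂_y`, `e₂ = ∂ᵥ`,
`e₃ = ∂ₓ - W ∂ᵥ - H₂ ∂_y`, `e₄ = ∂_y`; row `a` holds the components of the `a`-th vector. -/
def nullFrame (H₁ H₂ W : (Fin 4 → ℝ) → ℝ) (p : Fin 4 → ℝ) : Matrix (Fin 4) (Fin 4) ℝ :=
  !![1, -H₁ p, 0, -W p;
     0, 1, 0, 0;
     0, -W p, 1, -H₂ p;
     0, 0, 0, 1]

/-- `nullFrame` is the dual frame of `coframe`. -/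
theorem coframe_mul_nullFrame (H₁ H₂ W : (Fin 4 → ℝ) → ℝ) (p : Fin 4 → ℝ) :
    coframe H₁ H₂ W p * (nullFrame H₁ H₂ W p).transpose = 1 := by
  ext i j
  fin_cases i <;> fin_cases j <;>
    simp [coframe, nullFrame, Matrix.mul_apply, Fin.sum_univ_four]

/-- The Walker metric is `2 ω¹ ω² + 2 ω³ ω⁴`. -/
theorem walkerMetric_eq (H₁ H₂ W : (Fin 4 → ℝ) → ℝ) (p : Fin 4 → ℝ) :
    walkerMetric H₁ H₂ W p = (coframe H₁ H₂ W p).transpose *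
      !![0, 1, 0, 0; 1, 0, 0, 0; 0, 0, 0, 1; 0, 0, 1, 0] * coframe H₁ H₂ W p := by
  ext i j
  fin_cases i <;> fin_cases j <;>
    simp [coframe, walkerMetric, Matrix.mul_apply, Fin.sum_univ_four] <;> ring

/-- The component `T(E_{a₁}, …, E_{aₖ})` at `p`, where row `a` of `E` is the frame vector `E_a`. -/
def frameComponent {k : ℕ} (E : Matrix (Fin 4) (Fin 4) ℝ) (T : CovTensor 4 k) (a : Fin k → Fin 4)
    (p : Fin 4 → ℝ) : ℝ :=
  ∑ I : Fin k → Fin 4, (∏ s, E (a s) (I s)) * T I p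

/-- First boost weight of a component with lower frame indices `a`: the boost
`ω¹ ↦ e^{l₁} ω¹`, `ω² ↦ e^{-l₁} ω²` multiplies the component by `e^{b₁ l₁}`. -/
def boostWeight₁ {k : ℕ} (a : Fin k → Fin 4) : ℤ := ∑ s, (![-1, 1, 0, 0] : Fin 4 → ℤ) (a s)

/-- Second boost weight of a component with lower frame indices `a`: the boost
`ω³ ↦ e^{l₂} ω³`, `ω⁴ ↦ e^{-l₂} ω⁴` multiplies the component by `e^{b₂ l₂}`. -/
def boostWeight₂ {k : ℕ} (a : Fin k → Fin 4) : ℤ := ∑ s, (![0, 0, -1, 1] : Fin 4 → ℤ) (a s)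

/-- The frame dual to the boosted coframe `(e^{l₁} ω¹, e^{-l₁} ω², e^{l₂} ω³, e^{-l₂} ω⁴)`. -/
def boostedFrame (l₁ l₂ : ℝ) (E : Matrix (Fin 4) (Fin 4) ℝ) : Matrix (Fin 4) (Fin 4) ℝ :=
  Matrix.diagonal ![Real.exp (-l₁), Real.exp l₁, Real.exp (-l₂), Real.exp l₂] * E

/-- The boost weights describe the behaviour of components under the two boosts. -/
theorem frameComponent_boostedFrame {k : ℕ} (l₁ l₂ : ℝ) (E : Matrix (Fin 4) (Fin 4) ℝ)
    (T : CovTensor 4 k) (a : Fin k → Fin 4) (p : Fin 4 → ℝ) :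
    frameComponent (boostedFrame l₁ l₂ E) T a p =
      Real.exp (boostWeight₁ a * l₁ + boostWeight₂ a * l₂) * frameComponent E T a p := by
  have h : ∀ b : Fin 4,
      (![Real.exp (-l₁), Real.exp l₁, Real.exp (-l₂), Real.exp l₂] : Fin 4 → ℝ) b =
        Real.exp ((((![-1, 1, 0, 0] : Fin 4 → ℤ) b : ℤ) : ℝ) * l₁
          + (((![0, 0, -1, 1] : Fin 4 → ℤ) b : ℤ) : ℝ) * l₂) := by
    intro b
    fin_cases b <;> simp
  simp only [frameComponent, boostedFrame, Matrix.diagonal_mul, h, Finset.prod_mul_distrib,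
    ← Real.exp_sum, Finset.sum_add_distrib, ← Finset.sum_mul, boostWeight₁, boostWeight₂,
    Int.cast_sum, Finset.mul_sum, mul_assoc]

/-- The `N`-property on `U` with respect to a frame field `E`: all components of boost weight
`(b₁, b₂)` with `b₁ > 0`, or with `b₁ = 0` and `b₂ ≥ 0`, vanish. -/
def NProperty {k : ℕ} (E : (Fin 4 → ℝ) → Matrix (Fin 4) (Fin 4) ℝ) (U : Set (Fin 4 → ℝ))
    (T : CovTensor 4 k) : Prop :=
  ∀ p ∈ U, ∀ a : Fin k → Fin 4,
    (0 < boostWeight₁ a ∨ (boostWeight₁ a = 0 ∧ 0 ≤ boostWeight₂ a)) →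
      frameComponent (E p) T a p = 0

end Walker

end

set_option linter.unusedSectionVars false

/-! Order pairs of boost weights lexicographically. The `N`-property says that a component can be
nonzero only if its weight is negative. Each null frame vector is a coordinate vector plus
coordinate vectors of higher weight, so it suffices to treat coordinate components (`LexVanishes`,
`LexVanishes.nProperty`). A nonzero inverse metric component has nonnegative total weight, so a
nonzero term of a complete contraction would have slots of nonnegative total weight while each
curvature factor contributes a negative one. Hence the `N`-property of the factors makes every
invariant vanish (`fullContraction_eq_zero`).

If `H₂₁₀ = 0`, give each coordinate the weight of its index and bound functions by the weight of
their nonvanishing iterated derivatives (`HasWeightLE`). This filtration is multiplicative, and a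
derivative lowers the bound by the weight of its direction. The nonconstant metric components lie
`(0, 1)` below the homogeneous bound. Every curvature formula is homogeneous and contains a
derivative of the metric, so the gap persists in all `∇ᵏR` (`HasWeightLE.nablaRiemann`). A component
of nonnegative boost weight then has a negative bound and is zero.

If `H₂₁₀ ≠ 0`, the term `v H₂₁₀` has weight `(1, 0)`, above the bound `(0, 1)` required of `H₂`, and
the filtration argument fails. For `R` and `∇R` the degrees of `H₁`, `H₂`, `W` in `v` and `y` still
suffice. With Christoffel symbols of the first kind and the antisymmetries of `R`, the individual
terms of each relevant component vanish, which is a finite check over indices (`riemann_pattern`,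
`partialDeriv_riemann_pattern`, `covDeriv_riemann_pattern`). -/

namespace Walker

/-! ### Partial derivatives and their iterates -/

section Calculus

variable {n : ℕ} {U : Set (Fin n → ℝ)} {f g : (Fin n → ℝ) → ℝ} {p : Fin n → ℝ}

theorem partialDeriv_congr (hU : IsOpen U) (h : Set.EqOn f g U) (i : Fin n) :
    Set.EqOn (partialDeriv i f) (partialDeriv i g) U := by
  intro p hp
  have : f =ᶠ[nhds p] g := Filter.eventuallyEq_of_mem (hU.mem_nhds hp) h
  simp [partialDeriv, this.fderiv_eq]

theorem contDiffOn_partialDeriv (hU : IsOpen U) (hf : ContDiffOn ℝ ∞ f U) (i : Fin n) :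
    ContDiffOn ℝ ∞ (partialDeriv i f) U :=
  (hf.fderiv_of_isOpen hU (by simp)).clm_apply contDiffOn_const

theorem differentiableAt_of_contDiffOn (hU : IsOpen U) (hf : ContDiffOn ℝ ∞ f U) (hp : p ∈ U) :
    DifferentiableAt ℝ f p :=
  (hf.contDiffAt (hU.mem_nhds hp)).differentiableAt (by simp)

theorem partialDeriv_const (i : Fin n) (c : ℝ) (p : Fin n → ℝ) :
    partialDeriv i (fun _ => c) p = 0 := by
  simp [partialDeriv]

theorem partialDeriv_add (hf : DifferentiableAt ℝ f p) (hg : DifferentiableAt ℝ g p)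
    (i : Fin n) :
    partialDeriv i (fun q => f q + g q) p = partialDeriv i f p + partialDeriv i g p := by
  simp [partialDeriv, fderiv_fun_add hf hg]

theorem partialDeriv_sub (hf : DifferentiableAt ℝ f p) (hg : DifferentiableAt ℝ g p)
    (i : Fin n) :
    partialDeriv i (fun q => f q - g q) p = partialDeriv i f p - partialDeriv i g p := by
  simp [partialDeriv, fderiv_fun_sub hf hg]

theorem partialDeriv_mul (hf : DifferentiableAt ℝ f p) (hg : DifferentiableAt ℝ g p)
    (i : Fin n) :
    partialDeriv i (fun q => f q * g q) p
      = partialDeriv i f p * g p + f p * partialDeriv i g p := by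
  simp [partialDeriv, fderiv_fun_mul hf hg]
  ring

theorem partialDeriv_const_mul (hf : DifferentiableAt ℝ f p) (c : ℝ) (i : Fin n) :
    partialDeriv i (fun q => c * f q) p = c * partialDeriv i f p := by
  simp [partialDeriv, fderiv_const_mul hf]

theorem partialDeriv_sum {ι : Type*} {s : Finset ι} {F : ι → (Fin n → ℝ) → ℝ}
    (hF : ∀ a ∈ s, DifferentiableAt ℝ (F a) p) (i : Fin n) :
    partialDeriv i (fun q => ∑ a ∈ s, F a q) p = ∑ a ∈ s, partialDeriv i (F a) p := by
  simp [partialDeriv, fderiv_fun_sum hF]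

theorem partialDeriv_coord (i j : Fin n) (p : Fin n → ℝ) :
    partialDeriv i (fun q => q j) p = (Pi.single i 1 : Fin n → ℝ) j := by
  have : fderiv ℝ (fun q : Fin n → ℝ => q j) p = ContinuousLinearMap.proj j :=
    (ContinuousLinearMap.proj (R := ℝ) (φ := fun _ : Fin n => ℝ) j).fderiv
  simp [partialDeriv, this]

theorem partialDeriv_comm (hU : IsOpen U) (hf : ContDiffOn ℝ ∞ f U) (hp : p ∈ U) (i j : Fin n) :
    partialDeriv i (partialDeriv j f) p = partialDeriv j (partialDeriv i f) p := by
  have hd : DifferentiableAt ℝ (fderiv ℝ f) p :=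
    ((hf.fderiv_of_isOpen hU (m := ∞) (by simp)).contDiffAt (hU.mem_nhds hp)).differentiableAt
      (by simp)
  have hs : IsSymmSndFDerivAt ℝ f p :=
    (hf.contDiffAt (hU.mem_nhds hp)).isSymmSndFDerivAt (by
      simp only [minSmoothness_of_isRCLikeNormedField]
      exact WithTop.coe_le_coe.2 (le_top : (2 : ℕ∞) ≤ ⊤))
  have key : ∀ a b : Fin n, partialDeriv a (partialDeriv b f) p
      = fderiv ℝ (fderiv ℝ f) p (Pi.single a 1) (Pi.single b 1) := by
    intro a b
    have : partialDeriv b f = fun q => fderiv ℝ f q (Pi.single b 1) := rfl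
    rw [this, partialDeriv, fderiv_clm_apply hd (differentiableAt_const _)]
    simp
  rw [key, key]
  exact hs _ _

/-- The iterated partial derivative along a list of directions, the head of the list first. -/
noncomputable def iterPartial : List (Fin n) → ((Fin n → ℝ) → ℝ) → (Fin n → ℝ) → ℝ
  | [], f => f
  | i :: L, f => iterPartial L (partialDeriv i f)

theorem iterPartial_congr (hU : IsOpen U) (L : List (Fin n)) (h : Set.EqOn f g U) :
    Set.EqOn (iterPartial L f) (iterPartial L g) U := by
  induction L generalizing f g with
  | nil => exact h
  | cons i L ih => exact ih (partialDeriv_congr hU h i)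

theorem iterPartial_zero (L : List (Fin n)) : iterPartial L (fun _ => (0 : ℝ)) = fun _ => 0 := by
  induction L with
  | nil => rfl
  | cons i L ih =>
    have : partialDeriv i (fun _ : Fin n → ℝ => (0 : ℝ)) = fun _ => 0 :=
      funext (partialDeriv_const i 0)
    rw [iterPartial, this, ih]

theorem iterPartial_add (hU : IsOpen U) (L : List (Fin n)) (hf : ContDiffOn ℝ ∞ f U)
    (hg : ContDiffOn ℝ ∞ g U) (hp : p ∈ U) :
    iterPartial L (fun q => f q + g q) p = iterPartial L f p + iterPartial L g p := by
  induction L generalizing f g with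
  | nil => rfl
  | cons i L ih =>
    rw [iterPartial, iterPartial, iterPartial, ← ih (contDiffOn_partialDeriv hU hf i)
      (contDiffOn_partialDeriv hU hg i)]
    exact iterPartial_congr hU L (fun q hq => partialDeriv_add
      (differentiableAt_of_contDiffOn hU hf hq) (differentiableAt_of_contDiffOn hU hg hq) i) hp

theorem partialDeriv_translate {i : Fin n} (h : ∀ p t, f (p + Pi.single i t) = f p) (k : Fin n)
    (p : Fin n → ℝ) (t : ℝ) :
    partialDeriv k f (p + Pi.single i t) = partialDeriv k f p := by
  have : (fun q => f (q + Pi.single i t)) = f := funext fun q => h q t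
  rw [partialDeriv, ← fderiv_comp_add_right, this, partialDeriv]

theorem partialDeriv_eq_zero_of_translate {i : Fin n} (h : ∀ p t, f (p + Pi.single i t) = f p)
    (p : Fin n → ℝ) : partialDeriv i f p = 0 := by
  by_cases hd : DifferentiableAt ℝ f p
  · rw [partialDeriv, ← hd.lineDeriv_eq_fderiv, lineDeriv]
    have : (fun t : ℝ => f (p + t • (Pi.single i 1 : Fin n → ℝ))) = fun _ => f p := by
      funext t
      rw [← h p t, ← Pi.single_smul]
      simp
    rw [this]
    simp
  -- At points without differentiability `fderiv` is zero by convention, so no smoothness is needed.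
  · simp [partialDeriv, fderiv_zero_of_not_differentiableAt hd]

/-- Translation invariance passes to every partial derivative, so it is still available when the
direction `i` is reached in `L`; mixed partials need not commute. -/
theorem iterPartial_eq_zero_of_translate {i : Fin n} (h : ∀ p t, f (p + Pi.single i t) = f p)
    {L : List (Fin n)} (hi : i ∈ L) (p : Fin n → ℝ) : iterPartial L f p = 0 := by
  induction L generalizing f with
  | nil => simp at hi
  | cons k L ih =>
    rw [iterPartial]
    rcases List.mem_cons.1 hi with rfl | hi
    · rw [show partialDeriv i f = fun _ => 0 from funext (partialDeriv_eq_zero_of_translate h),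
        iterPartial_zero]
    · exact ih (partialDeriv_translate h k) hi

end Calculus

/-! ### The filtration of smooth functions by weight -/

section Weight

variable {n : ℕ} {Γ : Type*} [AddCommGroup Γ] [LinearOrder Γ] [IsOrderedAddMonoid Γ]
  {U : Set (Fin n → ℝ)} {b : Fin n → Γ} {w w' : Γ} {f g : (Fin n → ℝ) → ℝ}

/-- `f` is smooth on `U` and, the direction `i` having weight `b i`, all its iterated partial
derivatives of total weight above `w` vanish on `U`. -/
def HasWeightLE (U : Set (Fin n → ℝ)) (b : Fin n → Γ) (w : Γ) (f : (Fin n → ℝ) → ℝ) : Prop :=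
  ContDiffOn ℝ ∞ f U ∧ ∀ L : List (Fin n), w < (L.map b).sum → ∀ p ∈ U, iterPartial L f p = 0

namespace HasWeightLE

theorem eq_zero (h : HasWeightLE U b w f) (hw : w < 0) {p : Fin n → ℝ} (hp : p ∈ U) : f p = 0 :=
  h.2 [] (by simpa using hw) p hp

theorem mono (h : HasWeightLE U b w f) (hw : w ≤ w') : HasWeightLE U b w' f :=
  ⟨h.1, fun L hL => h.2 L (hw.trans_lt hL)⟩

theorem congr (hU : IsOpen U) (h : HasWeightLE U b w f) (hfg : Set.EqOn g f U) :
    HasWeightLE U b w g :=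
  ⟨h.1.congr hfg, fun L hL p hp => (iterPartial_congr hU L hfg hp).trans (h.2 L hL p hp)⟩

theorem partialDeriv (hU : IsOpen U) (h : HasWeightLE U b w f) (i : Fin n) :
    HasWeightLE U b (w - b i) (partialDeriv i f) :=
  ⟨contDiffOn_partialDeriv hU h.1 i, fun L hL => h.2 (i :: L) (by
    simpa [sub_lt_iff_lt_add'] using hL)⟩

/-- As `0 ≤ w`, the empty list imposes no condition, and every other list starts with a first
derivative. -/
theorem of_partialDeriv (hf : ContDiffOn ℝ ∞ f U) (h0 : 0 ≤ w)
    (h : ∀ i, HasWeightLE U b (w - b i) (Walker.partialDeriv i f)) : HasWeightLE U b w f := by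
  refine ⟨hf, fun L hL => ?_⟩
  cases L with
  | nil => exact absurd (by simpa using hL) h0.not_gt
  | cons i L => exact (h i).2 L (by simpa [sub_lt_iff_lt_add'] using hL)

theorem zero : HasWeightLE U b w (fun _ => 0) :=
  ⟨contDiffOn_const, fun L _ p _ => by rw [iterPartial_zero]⟩

theorem const (c : ℝ) (hw : 0 ≤ w) : HasWeightLE U b w (fun _ => c) :=
  of_partialDeriv contDiffOn_const hw fun i => by
    rw [show Walker.partialDeriv i (fun _ : Fin n → ℝ => c) = fun _ => 0 from
      funext (partialDeriv_const i c)]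
    exact zero

theorem add (hU : IsOpen U) (hf : HasWeightLE U b w f) (hg : HasWeightLE U b w g) :
    HasWeightLE U b w (fun q => f q + g q) :=
  ⟨hf.1.add hg.1, fun L hL p hp => by
    rw [iterPartial_add hU L hf.1 hg.1 hp, hf.2 L hL p hp, hg.2 L hL p hp, add_zero]⟩

/-- Leibniz rule, by induction on the list for all bounds at once. For the empty list, `w + w' < 0`
forces one of the bounds to be negative, so that factor is zero. -/
theorem mul (hU : IsOpen U) (hf : HasWeightLE U b w f) (hg : HasWeightLE U b w' g) :
    HasWeightLE U b (w + w') (fun q => f q * g q) := by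
  refine ⟨hf.1.mul hg.1, fun L => ?_⟩
  induction L generalizing f g w w' with
  | nil =>
    intro hL p hp
    change f p * g p = 0
    rcases lt_or_ge w 0 with h | h
    · rw [hf.eq_zero h hp, zero_mul]
    · rw [hg.eq_zero ((le_add_of_nonneg_left h).trans_lt (by simpa using hL)) hp, mul_zero]
  | cons i L ih =>
    intro hL p hp
    have hL' : w + w' < b i + (L.map b).sum := by simpa using hL
    have e : Set.EqOn (Walker.partialDeriv i fun q => f q * g q)
        (fun q => Walker.partialDeriv i f q * g q + f q * Walker.partialDeriv i g q) U :=
      fun q hq => partialDeriv_mul (differentiableAt_of_contDiffOn hU hf.1 hq)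
        (differentiableAt_of_contDiffOn hU hg.1 hq) i
    have hf' := hf.partialDeriv hU i
    have hg' := hg.partialDeriv hU i
    rw [iterPartial, iterPartial_congr hU L e hp, iterPartial_add hU L (hf'.1.mul hg.1)
      (hf.1.mul hg'.1) hp, ih hf' hg _ p hp, ih hf hg' _ p hp, add_zero]
    · rwa [← add_sub_assoc, sub_lt_iff_lt_add']
    · rwa [sub_add_eq_add_sub, sub_lt_iff_lt_add']

theorem const_mul (hU : IsOpen U) (c : ℝ) (hf : HasWeightLE U b w f) :
    HasWeightLE U b w (fun q => c * f q) := by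
  simpa using (const c le_rfl).mul hU hf

theorem sub (hU : IsOpen U) (hf : HasWeightLE U b w f) (hg : HasWeightLE U b w g) :
    HasWeightLE U b w (fun q => f q - g q) := by
  simpa [sub_eq_add_neg] using hf.add hU (hg.const_mul hU (-1))

theorem sum (hU : IsOpen U) {ι : Type*} {s : Finset ι} {F : ι → (Fin n → ℝ) → ℝ}
    (h : ∀ a ∈ s, HasWeightLE U b w (F a)) : HasWeightLE U b w (fun q => ∑ a ∈ s, F a q) := by
  classical
  induction s using Finset.induction_on with
  | empty => simpa using zero
  | insert a s ha ih =>
    simp only [Finset.sum_insert ha]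
    exact (h a (by simp)).add hU (ih fun c hc => h c (by simp [hc]))

theorem coord (j : Fin n) (hj : 0 ≤ b j) : HasWeightLE U b (b j) (fun q => q j) := by
  refine of_partialDeriv (contDiff_apply ℝ ℝ j).contDiffOn hj fun i => ?_
  rw [show Walker.partialDeriv i (fun q : Fin n → ℝ => q j) = fun _ => (Pi.single i 1 : Fin n → ℝ) j
    from funext (partialDeriv_coord i j)]
  by_cases h : j = i
  · subst h
    exact const _ (sub_self (b j)).ge
  · simpa [Pi.single_eq_of_ne h] using zero

theorem of_translate (hf : ContDiffOn ℝ ∞ f U) (J : Set (Fin n))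
    (hJ : ∀ i ∈ J, ∀ p t, f (p + Pi.single i t) = f p)
    (hw : ∀ L : List (Fin n), (∀ i ∈ L, i ∉ J) → (L.map b).sum ≤ w) : HasWeightLE U b w f := by
  refine ⟨hf, fun L hL p _ => ?_⟩
  obtain ⟨i, hiL, hiJ⟩ : ∃ i ∈ L, i ∈ J := by
    by_contra! h
    exact (hw L h).not_gt hL
  exact iterPartial_eq_zero_of_translate (hJ i hiJ) hiL p

end HasWeightLE

end Weight

/-! ### Boost weights, null frame and complete contractions -/

section Pointwise

/-- The pair of boost weights of a lower index, ordered lexicographically. -/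
def boostWeight (i : Fin 4) : ℤ ×ₗ ℤ :=
  toLex ((![-1, 1, 0, 0] : Fin 4 → ℤ) i, (![0, 0, -1, 1] : Fin 4 → ℤ) i)

theorem ofLex_sum_boostWeight {ι : Type*} (s : Finset ι) (a : ι → Fin 4) :
    ofLex (∑ i ∈ s, boostWeight (a i)) =
      (∑ i ∈ s, (![-1, 1, 0, 0] : Fin 4 → ℤ) (a i), ∑ i ∈ s, (![0, 0, -1, 1] : Fin 4 → ℤ) (a i)) := by
  classical
  induction s using Finset.induction_on with
  | empty => rfl
  | insert c s hc ih =>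
    rw [Finset.sum_insert hc, Finset.sum_insert hc, Finset.sum_insert hc, ofLex_add, ih]
    rfl

theorem sum_boostWeight_nonneg_iff {k : ℕ} (a : Fin k → Fin 4) :
    0 ≤ ∑ s, boostWeight (a s) ↔
      0 < boostWeight₁ a ∨ (boostWeight₁ a = 0 ∧ 0 ≤ boostWeight₂ a) := by
  rw [Prod.Lex.le_iff, ofLex_sum_boostWeight]
  simp [boostWeight₁, boostWeight₂, eq_comm]

/-- The coordinate components of `T` of lexicographically nonnegative boost weight vanish. -/
def LexVanishes {k : ℕ} (U : Set (Fin 4 → ℝ)) (T : CovTensor 4 k) : Prop :=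
  ∀ I : Fin k → Fin 4, 0 ≤ ∑ s, boostWeight (I s) → ∀ p ∈ U, T I p = 0

variable {H₁ H₂ W : (Fin 4 → ℝ) → ℝ} {U : Set (Fin 4 → ℝ)}

theorem boostWeight_le_of_nullFrame_ne_zero {p : Fin 4 → ℝ} {a i : Fin 4}
    (h : nullFrame H₁ H₂ W p a i ≠ 0) : boostWeight a ≤ boostWeight i := by
  revert h
  fin_cases a <;> fin_cases i <;>
    simp [nullFrame, boostWeight, Prod.Lex.le_iff]

/-- The frame is triangular for the weight order: expanding a frame component meets only coordinate
components of at least the same weight. -/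
theorem LexVanishes.nProperty {k : ℕ} {T : CovTensor 4 k} (h : LexVanishes U T) :
    NProperty (nullFrame H₁ H₂ W) U T := by
  intro p hp a ha
  refine Finset.sum_eq_zero fun I _ => ?_
  by_cases h0 : ∏ s, nullFrame H₁ H₂ W p (a s) (I s) = 0
  · rw [h0, zero_mul]
  · rw [h I (((sum_boostWeight_nonneg_iff a).2 ha).trans (Finset.sum_le_sum fun s hs =>
      boostWeight_le_of_nullFrame_ne_zero (Finset.prod_ne_zero_iff.1 h0 s hs))) p hp, mul_zero]

theorem walkerMetric_inv (p : Fin 4 → ℝ) :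
    (walkerMetric H₁ H₂ W p)⁻¹ =
      !![0, 1, 0, 0; 1, -2 * H₁ p, 0, -2 * W p; 0, 0, 0, 1; 0, -2 * W p, 1, -2 * H₂ p] := by
  apply Matrix.inv_eq_right_inv
  ext i j
  fin_cases i <;> fin_cases j <;> simp [walkerMetric, Matrix.mul_apply, Fin.sum_univ_four]

theorem boostWeight_add_nonneg_of_inv_ne_zero {p : Fin 4 → ℝ} {i j : Fin 4}
    (h : (walkerMetric H₁ H₂ W p)⁻¹ i j ≠ 0) : 0 ≤ boostWeight i + boostWeight j := by
  revert h
  rw [walkerMetric_inv]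
  fin_cases i <;> fin_cases j <;>
    simp [boostWeight, Prod.Lex.le_iff]

/-- A nonzero summand would give the total weight of all slots two signs: nonnegative when grouped
by contracted pairs, negative when grouped by curvature factors. -/
theorem fullContraction_eq_zero {m r : ℕ} {ks : Fin m → ℕ} (e : (Fin r ⊕ Fin r) ≃ Slot ks)
    (hm : 0 < m) (h : ∀ i, LexVanishes U (nablaRiemann (walkerMetric H₁ H₂ W) (ks i)))
    {p : Fin 4 → ℝ} (hp : p ∈ U) : fullContraction (walkerMetric H₁ H₂ W) ks e p = 0 := by
  refine Finset.sum_eq_zero fun I _ => ?_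
  by_contra hne
  obtain ⟨h1, h2⟩ := mul_ne_zero_iff.1 hne
  have hpos : 0 ≤ ∑ s : Slot ks, boostWeight (I s) := by
    rw [← e.sum_comp, Fintype.sum_sum_type, ← Finset.sum_add_distrib]
    exact Finset.sum_nonneg fun j hj =>
      boostWeight_add_nonneg_of_inv_ne_zero (Finset.prod_ne_zero_iff.1 h1 j hj)
  have hneg : ∑ s : Slot ks, boostWeight (I s) < 0 := by
    rw [Fintype.sum_sigma]
    -- Strictness of the inequality needs at least one factor.
    refine Finset.sum_neg (fun i hi => ?_) ⟨⟨0, hm⟩, Finset.mem_univ _⟩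
    by_contra hi'
    exact Finset.prod_ne_zero_iff.1 h2 i hi (h i _ (not_lt.1 hi') p hp)
  exact hneg.not_ge hpos

theorem isVSIOrder_of_lexVanishes {N : ℕ}
    (h : ∀ k ≤ N, LexVanishes U (nablaRiemann (walkerMetric H₁ H₂ W) k)) :
    IsVSIOrder (walkerMetric H₁ H₂ W) U N := by
  intro F hF p hp
  induction hF using Submodule.span_induction with
  | mem F hF =>
    obtain ⟨m, r, ks, e, hm, hks, rfl⟩ := hF
    exact fullContraction_eq_zero e hm (fun i => h _ (hks i)) hp
  | zero => rfl
  | add F G _ _ hF hG => simp [hF, hG]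
  | smul c F _ hF => simp [hF]

theorem isNeutralMetricOn_walkerMetric (h₁ : ContDiffOn ℝ ∞ H₁ U) (h₂ : ContDiffOn ℝ ∞ H₂ U)
    (hW : ContDiffOn ℝ ∞ W U) : IsNeutralMetricOn (walkerMetric H₁ H₂ W) U := by
  constructor
  · intro i j
    fin_cases i <;> fin_cases j <;> simp [walkerMetric] <;>
      first
      | exact contDiffOn_const
      | exact contDiffOn_const.mul h₁
      | exact contDiffOn_const.mul h₂
      | exact contDiffOn_const.mul hW
  · intro p _
    -- The columns are `e₁ - e₂/2`, `e₃ - e₄/2`, `e₁ + e₂/2`, `e₃ + e₄/2` for the null frame `e`.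
    let P : Matrix (Fin 4) (Fin 4) ℝ :=
      !![1, 0, 1, 0;
         -H₁ p - 1 / 2, -W p, -H₁ p + 1 / 2, -W p;
         0, 1, 0, 1;
         -W p, -H₂ p - 1 / 2, -W p, -H₂ p + 1 / 2]
    have hP : P.transpose * walkerMetric H₁ H₂ W p * P = Matrix.diagonal ![-1, -1, 1, 1] := by
      ext i j
      fin_cases i <;> fin_cases j <;>
        simp [P, walkerMetric, Matrix.mul_apply, Fin.sum_univ_four] <;> ring
    refine ⟨P, ?_, hP⟩
    have hd := congrArg Matrix.det hP
    rw [Matrix.det_mul, Matrix.det_diagonal] at hd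
    refine isUnit_iff_ne_zero.2 fun h0 => ?_
    rw [h0, mul_zero] at hd
    simp [Fin.prod_univ_four] at hd

end Pointwise

/-! ### Weight bounds for the curvature and its covariant derivatives -/

section WeightedGeometry

variable {n : ℕ} {Γ : Type*} [AddCommGroup Γ] [LinearOrder Γ] [IsOrderedAddMonoid Γ]
  {U : Set (Fin n → ℝ)} {b : Fin n → Γ} {ε : Γ}
  {g : (Fin n → ℝ) → Matrix (Fin n) (Fin n) ℝ}

/-- Homogeneity: an upper index counts `+b`, a lower index or a derivative `-b`. The gap `ε` comes
from the differentiated metric component. -/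
theorem HasWeightLE.christoffel (hU : IsOpen U)
    (hinv : ∀ i j, HasWeightLE U b (b i + b j) (fun p => (g p)⁻¹ i j))
    (hdg : ∀ k i j, HasWeightLE U b (-(b i + b j) - b k - ε)
      (Walker.partialDeriv k fun p => g p i j)) (l i j : Fin n) :
    HasWeightLE U b (b l - b i - b j - ε) (Walker.christoffel g l i j) := by
  refine (HasWeightLE.sum hU fun m _ => ?_).const_mul hU _
  refine ((hinv l m).mul hU (w' := -(b m + b i + b j) - ε) ?_).mono (le_of_eq (by abel))
  refine (((hdg i j m).mono (le_of_eq ?_)).add hU ((hdg j i m).mono (le_of_eq ?_))).sub hU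
    ((hdg m i j).mono (le_of_eq ?_)) <;> abel

theorem HasWeightLE.riemannUp (hU : IsOpen U) (hε : 0 ≤ ε)
    (hΓ : ∀ l i j, HasWeightLE U b (b l - b i - b j - ε) (Walker.christoffel g l i j))
    (e i c d : Fin n) :
    HasWeightLE U b (b e - b i - b c - b d - ε) (Walker.riemannUp g e i c d) := by
  refine ((((hΓ e d i).partialDeriv hU c).mono (le_of_eq ?_)).sub hU
    (((hΓ e c i).partialDeriv hU d).mono (le_of_eq ?_))).add hU (HasWeightLE.sum hU fun f _ =>
      (((hΓ e c f).mul hU (hΓ f d i)).mono ?_).sub hU (((hΓ e d f).mul hU (hΓ f c i)).mono ?_))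
  · abel
  · abel
  · rw [show b e - b c - b f - ε + (b f - b d - b i - ε) = b e - b i - b c - b d - ε - ε by abel]
    exact sub_le_self _ hε
  · rw [show b e - b d - b f - ε + (b f - b c - b i - ε) = b e - b i - b c - b d - ε - ε by abel]
    exact sub_le_self _ hε

theorem HasWeightLE.riemann (hU : IsOpen U) (hε : 0 ≤ ε)
    (hg : ∀ i j, HasWeightLE U b (-(b i + b j)) (fun p => g p i j))
    (hΓ : ∀ l i j, HasWeightLE U b (b l - b i - b j - ε) (Walker.christoffel g l i j))
    (I : Fin 4 → Fin n) :
    HasWeightLE U b (-∑ s, b (I s) - ε) (Walker.riemann g I) := by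
  refine HasWeightLE.sum hU fun e _ =>
    ((hg (I 0) e).mul hU (HasWeightLE.riemannUp hU hε hΓ e (I 1) (I 2) (I 3))).mono (le_of_eq ?_)
  rw [Fin.sum_univ_four]
  abel

/-- The derivative term keeps the gap `ε` of `T`. A Christoffel term has gap `2ε`, one from each
factor, and `0 ≤ ε` makes this enough. -/
theorem HasWeightLE.covDeriv (hU : IsOpen U) (hε : 0 ≤ ε)
    (hΓ : ∀ l i j, HasWeightLE U b (b l - b i - b j - ε) (Walker.christoffel g l i j))
    {k : ℕ} {T : CovTensor n k} (hT : ∀ I, HasWeightLE U b (-∑ s, b (I s) - ε) (T I))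
    (I : Fin (k + 1) → Fin n) :
    HasWeightLE U b (-∑ s, b (I s) - ε) (Walker.covDeriv g T I) := by
  rw [Fin.sum_univ_castSucc]
  refine (((hT _).partialDeriv hU _).mono (le_of_eq ?_)).sub hU
    (HasWeightLE.sum hU fun s _ => HasWeightLE.sum hU fun l _ =>
      ((hΓ l _ _).mul hU (hT _)).mono ?_)
  · abel
  -- Replacing the index in slot `s` by `l` changes the weight sum by `b l - b (I s.castSucc)`.
  · have e : ∑ s' : Fin k, b (Function.update (fun s' : Fin k => I s'.castSucc) s l s')
        = b l + (∑ s' : Fin k, b (I s'.castSucc) - b (I s.castSucc)) := by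
      have : ∀ s' : Fin k, b (Function.update (fun s' : Fin k => I s'.castSucc) s l s')
          = Function.update (fun s' : Fin k => b (I s'.castSucc)) s (b l) s' := fun s' : Fin k =>
        Function.apply_update (fun _ => b) _ _ _ _
      simp only [this]
      rw [Finset.sum_update_of_mem (Finset.mem_univ s),
        ← Finset.sum_erase_eq_sub (Finset.mem_univ s), Finset.sdiff_singleton_eq_erase]
    rw [e, show b l - b (I (Fin.last k)) - b (I s.castSucc) - ε
      + (-(b l + (∑ s' : Fin k, b (I s'.castSucc) - b (I s.castSucc))) - ε)
      = -(∑ s' : Fin k, b (I s'.castSucc) + b (I (Fin.last k))) - ε - ε by abel]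
    exact sub_le_self _ hε

theorem HasWeightLE.nablaRiemann (hU : IsOpen U) (hε : 0 ≤ ε)
    (hg : ∀ i j, HasWeightLE U b (-(b i + b j)) (fun p => g p i j))
    (hinv : ∀ i j, HasWeightLE U b (b i + b j) (fun p => (g p)⁻¹ i j))
    (hdg : ∀ k i j, HasWeightLE U b (-(b i + b j) - b k - ε)
      (Walker.partialDeriv k fun p => g p i j)) (k : ℕ) (I : Fin (4 + k) → Fin n) :
    HasWeightLE U b (-∑ s, b (I s) - ε) (Walker.nablaRiemann g k I) := by
  have hΓ := HasWeightLE.christoffel hU hinv hdg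
  induction k with
  | zero => exact HasWeightLE.riemann hU hε hg hΓ I
  | succ k ih => exact HasWeightLE.covDeriv hU hε hΓ ih I

end WeightedGeometry

/-! ### Covariant derivatives of all orders under the weight bounds -/

section Case2

variable {U : Set (Fin 4 → ℝ)} {H₁ H₂ W : (Fin 4 → ℝ) → ℝ}

/-- The weight `(0, 1)`. -/
def unitWeight : ℤ ×ₗ ℤ := toLex (0, 1)

theorem lexVanishes_nablaRiemann (hU : IsOpen U)
    (h₁ : HasWeightLE U boostWeight (toLex (2, -1)) H₁)
    (h₂ : HasWeightLE U boostWeight (toLex (0, 1)) H₂)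
    (hW : HasWeightLE U boostWeight (toLex (1, 0)) W) (k : ℕ) :
    LexVanishes U (nablaRiemann (walkerMetric H₁ H₂ W) k) := by
  have hε : (0 : ℤ ×ₗ ℤ) < unitWeight := by decide
  -- Only the constant components `1` miss the gap. They disappear on differentiation, and the gap
  -- is needed only for the derivatives of the metric.
  have key : ∀ i j, (∃ c : ℝ, 0 ≤ -(boostWeight i + boostWeight j) ∧
        (fun p => walkerMetric H₁ H₂ W p i j) = fun _ => c) ∨
      HasWeightLE U boostWeight (-(boostWeight i + boostWeight j) - unitWeight)
        (fun p => walkerMetric H₁ H₂ W p i j) := by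
    intro i j
    fin_cases i <;> fin_cases j <;> simp only [walkerMetric] <;>
      first
      | exact Or.inl ⟨1, by decide, rfl⟩
      | exact Or.inr HasWeightLE.zero
      | exact Or.inr (h₁.const_mul hU 2)
      | exact Or.inr (h₂.const_mul hU 2)
      | exact Or.inr (hW.const_mul hU 2)
  have hg : ∀ i j, HasWeightLE U boostWeight (-(boostWeight i + boostWeight j))
      (fun p => walkerMetric H₁ H₂ W p i j) := by
    intro i j
    rcases key i j with ⟨c, hc, h⟩ | h
    · rw [h]
      exact HasWeightLE.const c hc
    · exact h.mono (sub_le_self _ hε.le)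
  have hdg : ∀ k i j, HasWeightLE U boostWeight
      (-(boostWeight i + boostWeight j) - boostWeight k - unitWeight)
      (partialDeriv k fun p => walkerMetric H₁ H₂ W p i j) := by
    intro k i j
    rcases key i j with ⟨c, -, h⟩ | h
    · rw [h, show partialDeriv k (fun _ : Fin 4 → ℝ => c) = fun _ => 0 from
        funext (partialDeriv_const k c)]
      exact HasWeightLE.zero
    · exact (h.partialDeriv hU k).mono (le_of_eq (by abel))
  have hinv : ∀ i j, HasWeightLE U boostWeight (boostWeight i + boostWeight j)
      (fun p => (walkerMetric H₁ H₂ W p)⁻¹ i j) := by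
    intro i j
    simp only [walkerMetric_inv]
    fin_cases i <;> fin_cases j <;>
      first
      | exact HasWeightLE.zero
      | exact HasWeightLE.const 1 (by decide)
      | exact (h₁.const_mul hU (-2)).mono (by decide)
      | exact (h₂.const_mul hU (-2)).mono (by decide)
      | exact (hW.const_mul hU (-2)).mono (by decide)
  intro I hI p hp
  refine (HasWeightLE.nablaRiemann hU hε.le hg hinv hdg k I).eq_zero ?_ hp
  exact (sub_lt_self _ hε).trans_le (neg_nonpos.2 hI)

end Case2

/-! ### Curvature via Christoffel symbols of the first kind -/

section LoweredCurvature

variable {n : ℕ} {U : Set (Fin n → ℝ)} {g : (Fin n → ℝ) → Matrix (Fin n) (Fin n) ℝ}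

/-- The Christoffel symbol `Γ_{a,ij}` of the first kind. -/
noncomputable def christoffelLow (g : (Fin n → ℝ) → Matrix (Fin n) (Fin n) ℝ) (a i j : Fin n)
    (p : Fin n → ℝ) : ℝ :=
  (1 / 2 : ℝ) * (partialDeriv i (fun q => g q j a) p + partialDeriv j (fun q => g q i a) p
    - partialDeriv a (fun q => g q i j) p)

theorem christoffel_eq_sum (l i j : Fin n) (p : Fin n → ℝ) :
    christoffel g l i j p = ∑ m, (g p)⁻¹ l m * christoffelLow g m i j p := by
  rw [christoffel, Finset.mul_sum]
  exact Finset.sum_congr rfl fun m _ => by rw [christoffelLow]; ring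

theorem contDiffOn_christoffelLow (hU : IsOpen U)
    (hg : ∀ i j, ContDiffOn ℝ ∞ (fun p => g p i j) U) (a i j : Fin n) :
    ContDiffOn ℝ ∞ (christoffelLow g a i j) U :=
  contDiffOn_const.mul (((contDiffOn_partialDeriv hU (hg j a) i).add
    (contDiffOn_partialDeriv hU (hg i a) j)).sub (contDiffOn_partialDeriv hU (hg i j) a))

theorem contDiffOn_christoffel (hU : IsOpen U)
    (hg : ∀ i j, ContDiffOn ℝ ∞ (fun p => g p i j) U)
    (hinv : ∀ i j, ContDiffOn ℝ ∞ (fun p => (g p)⁻¹ i j) U) (l i j : Fin n) :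
    ContDiffOn ℝ ∞ (christoffel g l i j) U := by
  rw [show christoffel g l i j = fun p => ∑ m, (g p)⁻¹ l m * christoffelLow g m i j p from
    funext (christoffel_eq_sum l i j)]
  exact ContDiffOn.sum fun m _ => (hinv l m).mul (contDiffOn_christoffelLow hU hg m i j)

theorem sum_metric_mul_christoffel {p : Fin n → ℝ} (hdet : IsUnit (g p).det) (a i j : Fin n) :
    ∑ e, g p a e * christoffel g e i j p = christoffelLow g a i j p := by
  have h := congrFun (congrArg (fun A : Matrix (Fin n) (Fin n) ℝ =>
    A.mulVec fun m => christoffelLow g m i j p) (Matrix.mul_nonsing_inv (g p) hdet)) a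
  simp only [← Matrix.mulVec_mulVec, Matrix.one_mulVec] at h
  simp only [christoffel_eq_sum]
  exact h

theorem partialDeriv_metric (hsymm : ∀ p, (g p).IsSymm) (c a e : Fin n) (p : Fin n → ℝ) :
    partialDeriv c (fun q => g q a e) p = christoffelLow g a c e p + christoffelLow g e c a p := by
  have hs : ∀ i j, (fun q => g q i j) = fun q => g q j i := fun i j =>
    funext fun q => (hsymm q).apply j i
  rw [christoffelLow, christoffelLow, hs e a, hs c e]
  ring

/-- Differentiate `g_{ae} Γᵉ_{db} = Γ_{a,db}` and substitute `∂_c g_{ae} = Γ_{a,ce} + Γ_{e,ca}`; the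
part with `Γ_{a,ce}` is the quadratic term on the left. -/
theorem sum_metric_mul_partialDeriv_christoffel (hU : IsOpen U) (hsymm : ∀ p, (g p).IsSymm)
    (hdet : ∀ p, IsUnit (g p).det) (hg : ∀ i j, ContDiffOn ℝ ∞ (fun p => g p i j) U)
    (hinv : ∀ i j, ContDiffOn ℝ ∞ (fun p => (g p)⁻¹ i j) U) {p : Fin n → ℝ} (hp : p ∈ U)
    (a b c d : Fin n) :
    ∑ e, g p a e * (partialDeriv c (christoffel g e d b) p
        + ∑ f, christoffel g e c f p * christoffel g f d b p)
      = partialDeriv c (christoffelLow g a d b) p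
        - ∑ e, christoffelLow g e c a p * christoffel g e d b p := by
  have h1 : partialDeriv c (christoffelLow g a d b) p
      = ∑ e, ((christoffelLow g a c e p + christoffelLow g e c a p) * christoffel g e d b p
        + g p a e * partialDeriv c (christoffel g e d b) p) := by
    rw [show christoffelLow g a d b = fun q => ∑ e, g q a e * christoffel g e d b q from
      funext fun q => (sum_metric_mul_christoffel (hdet q) a d b).symm]
    rw [partialDeriv_sum fun e _ => (differentiableAt_of_contDiffOn hU (hg a e) hp).fun_mul
      (differentiableAt_of_contDiffOn hU (contDiffOn_christoffel hU hg hinv e d b) hp)]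
    refine Finset.sum_congr rfl fun e _ => ?_
    rw [partialDeriv_mul (differentiableAt_of_contDiffOn hU (hg a e) hp)
      (differentiableAt_of_contDiffOn hU (contDiffOn_christoffel hU hg hinv e d b) hp),
      partialDeriv_metric hsymm]
  have h2 : ∑ e, g p a e * ∑ f, christoffel g e c f p * christoffel g f d b p
      = ∑ f, christoffelLow g a c f p * christoffel g f d b p := by
    simp only [Finset.mul_sum, ← mul_assoc]
    rw [Finset.sum_comm]
    simp only [← Finset.sum_mul, sum_metric_mul_christoffel (hdet p)]
  simp only [mul_add, Finset.sum_add_distrib, add_mul] at h1 ⊢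
  rw [h1, h2]
  ring

/-- No derivative of the inverse metric remains in this form, so vanishing can be tested term by
term. -/
theorem riemann_eq (hU : IsOpen U) (hsymm : ∀ p, (g p).IsSymm)
    (hdet : ∀ p, IsUnit (g p).det) (hg : ∀ i j, ContDiffOn ℝ ∞ (fun p => g p i j) U)
    (hinv : ∀ i j, ContDiffOn ℝ ∞ (fun p => (g p)⁻¹ i j) U) {p : Fin n → ℝ} (hp : p ∈ U)
    (I : Fin 4 → Fin n) :
    riemann g I p = partialDeriv (I 2) (christoffelLow g (I 0) (I 3) (I 1)) p
      - partialDeriv (I 3) (christoffelLow g (I 0) (I 2) (I 1)) p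
      + ∑ e, ∑ m, ((g p)⁻¹ e m * (christoffelLow g e (I 3) (I 0) p
            * christoffelLow g m (I 2) (I 1) p)
          - (g p)⁻¹ e m * (christoffelLow g e (I 2) (I 0) p
            * christoffelLow g m (I 3) (I 1) p)) := by
  have key := sum_metric_mul_partialDeriv_christoffel hU hsymm hdet hg hinv hp (I 0) (I 1)
  have h1 := key (I 2) (I 3)
  have h2 := key (I 3) (I 2)
  have hq : ∀ c a d b, ∑ e, christoffelLow g e c a p * christoffel g e d b p
      = ∑ e, ∑ m, (g p)⁻¹ e m * (christoffelLow g e c a p * christoffelLow g m d b p) := by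
    intro c a d b
    refine Finset.sum_congr rfl fun e _ => ?_
    rw [christoffel_eq_sum, Finset.mul_sum]
    exact Finset.sum_congr rfl fun m _ => by ring
  rw [hq] at h1 h2
  simp only [Finset.sum_sub_distrib]
  have : riemann g I p = ∑ e, g p (I 0) e * (partialDeriv (I 2) (christoffel g e (I 3) (I 1)) p
        + ∑ f, christoffel g e (I 2) f p * christoffel g f (I 3) (I 1) p)
      - ∑ e, g p (I 0) e * (partialDeriv (I 3) (christoffel g e (I 2) (I 1)) p
        + ∑ f, christoffel g e (I 3) f p * christoffel g f (I 2) (I 1) p) := by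
    rw [riemann, ← Finset.sum_sub_distrib]
    refine Finset.sum_congr rfl fun e _ => ?_
    rw [riemannUp, Finset.sum_sub_distrib]
    ring
  rw [this, h1, h2]
  ring

theorem riemann_swap_right (I : Fin 4 → Fin n) (p : Fin n → ℝ) :
    riemann g (I ∘ Equiv.swap 2 3) p = -riemann g I p := by
  have e0 : (I ∘ Equiv.swap (2 : Fin 4) 3) 0 = I 0 := rfl
  have e1 : (I ∘ Equiv.swap (2 : Fin 4) 3) 1 = I 1 := rfl
  have e2 : (I ∘ Equiv.swap (2 : Fin 4) 3) 2 = I 3 := rfl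
  have e3 : (I ∘ Equiv.swap (2 : Fin 4) 3) 3 = I 2 := rfl
  rw [riemann, riemann, e0, e1, e2, e3, ← Finset.sum_neg_distrib]
  refine Finset.sum_congr rfl fun e _ => ?_
  simp only [riemannUp, Finset.sum_sub_distrib]
  ring

theorem partialDeriv_christoffelLow (hU : IsOpen U)
    (hg : ∀ i j, ContDiffOn ℝ ∞ (fun p => g p i j) U) {p : Fin n → ℝ} (hp : p ∈ U)
    (k a i j : Fin n) :
    partialDeriv k (christoffelLow g a i j) p =
      (1 / 2 : ℝ) * (partialDeriv k (partialDeriv i fun q => g q j a) p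
        + partialDeriv k (partialDeriv j fun q => g q i a) p
        - partialDeriv k (partialDeriv a fun q => g q i j) p) := by
  have hd : ∀ k i j, DifferentiableAt ℝ (partialDeriv k fun q => g q i j) p := fun k i j =>
    differentiableAt_of_contDiffOn hU (contDiffOn_partialDeriv hU (hg i j) k) hp
  have e : christoffelLow g a i j = fun q => (1 / 2 : ℝ) * (partialDeriv i (fun q => g q j a) q
    + partialDeriv j (fun q => g q i a) q - partialDeriv a (fun q => g q i j) q) := rfl
  rw [e, partialDeriv_const_mul (((hd _ _ _).fun_add (hd _ _ _)).fun_sub (hd _ _ _)),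
    partialDeriv_sub ((hd _ _ _).fun_add (hd _ _ _)) (hd _ _ _),
    partialDeriv_add (hd _ _ _) (hd _ _ _)]

theorem riemann_swap_left (hU : IsOpen U) (hsymm : ∀ p, (g p).IsSymm)
    (hdet : ∀ p, IsUnit (g p).det) (hg : ∀ i j, ContDiffOn ℝ ∞ (fun p => g p i j) U)
    (hinv : ∀ i j, ContDiffOn ℝ ∞ (fun p => (g p)⁻¹ i j) U) {p : Fin n → ℝ} (hp : p ∈ U)
    (I : Fin 4 → Fin n) :
    riemann g (I ∘ Equiv.swap 0 1) p = -riemann g I p := by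
  have e0 : (I ∘ Equiv.swap (0 : Fin 4) 1) 0 = I 1 := rfl
  have e1 : (I ∘ Equiv.swap (0 : Fin 4) 1) 1 = I 0 := rfl
  have e2 : (I ∘ Equiv.swap (0 : Fin 4) 1) 2 = I 2 := rfl
  have e3 : (I ∘ Equiv.swap (0 : Fin 4) 1) 3 = I 3 := rfl
  rw [riemann_eq hU hsymm hdet hg hinv hp, riemann_eq hU hsymm hdet hg hinv hp, e0, e1, e2, e3]
  have hq : ∀ c a d b, ∑ e, ∑ m, (g p)⁻¹ e m * (christoffelLow g e c a p
        * christoffelLow g m d b p)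
      = ∑ e, ∑ m, (g p)⁻¹ e m * (christoffelLow g e d b p * christoffelLow g m c a p) := by
    intro c a d b
    rw [Finset.sum_comm]
    refine Finset.sum_congr rfl fun m _ => Finset.sum_congr rfl fun e _ => ?_
    rw [(hsymm p).inv.apply m e]
    ring
  have hs : ∀ i j, (fun q => g q i j) = fun q => g q j i := fun i j =>
    funext fun q => (hsymm q).apply j i
  -- The quadratic terms are exchanged by symmetry of the inverse metric. Among the second
  -- derivatives, those of `g_{ab}` cancel because partial derivatives commute; the rest is
  -- antisymmetric.
  simp only [Finset.sum_sub_distrib, partialDeriv_christoffelLow hU hg hp]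
  rw [hq (I 3) (I 1) (I 2) (I 0), hq (I 2) (I 1) (I 3) (I 0), hs (I 0) (I 1),
    partialDeriv_comm hU (hg _ _) hp (I 2) (I 3)]
  ring

/-- If `T` changes sign under `σ` and the tensor indices are `σ`-invariant, the differentiated
component is identically zero on `U`, and reindexing the Christoffel sum by `σ` shows that it equals
its own negative. -/
theorem covDeriv_eq_zero_of_swap {k : ℕ} {T : CovTensor n k} (hU : IsOpen U)
    (σ : Equiv.Perm (Fin k)) (hT : ∀ I, ∀ p ∈ U, T (I ∘ σ) p = -T I p)
    {I : Fin (k + 1) → Fin n} (hI : ∀ s, I (σ s).castSucc = I s.castSucc)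
    {p : Fin n → ℝ} (hp : p ∈ U) : covDeriv g T I p = 0 := by
  set J : Fin k → Fin n := fun s => I s.castSucc with hJ
  have hJσ : J ∘ σ = J := funext hI
  have h0 : Set.EqOn (T J) (fun _ => 0) U := by
    intro q hq
    have := hT J q hq
    rw [hJσ] at this
    change T J q = 0
    linarith
  have h1 : partialDeriv (I (Fin.last k)) (T J) p = 0 :=
    (partialDeriv_congr hU h0 _ hp).trans (partialDeriv_const _ _ _)
  have h2 : ∀ s l, T (Function.update J (σ s) l) p = -T (Function.update J s l) p := by
    intro s l
    have := hT (Function.update J (σ s) l) p hp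
    rw [Function.update_comp_eq_of_injective _ σ.injective, hJσ] at this
    rw [this, neg_neg]
  have h3 : ∑ s : Fin k, ∑ l : Fin n, christoffel g l (I (Fin.last k)) (J s) p
        * T (Function.update J s l) p
      = -∑ s : Fin k, ∑ l : Fin n, christoffel g l (I (Fin.last k)) (J s) p
        * T (Function.update J s l) p := by
    conv_lhs => rw [← Equiv.sum_comp σ]
    simp only [h2, show ∀ s, J (σ s) = J s from hI, mul_neg, Finset.sum_neg_distrib]
  change partialDeriv (I (Fin.last k)) (T J) p - ∑ s : Fin k, ∑ l : Fin n,
    christoffel g l (I (Fin.last k)) (J s) p * T (Function.update J s l) p = 0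
  rw [h1]
  linarith

end LoweredCurvature

/-! ### Index patterns forcing `R` and `∇R` to vanish -/

section VanishingPatterns

/-- A sufficient condition for the iterated partial derivative along `L` of the component `g_{ij}`
of the Walker metric to vanish. -/
def metricJetVanishes (L : List (Fin 4)) (i j : Fin 4) : Bool :=
  match i, j with
  | 0, 0 => decide (1 < L.count 1)
  | 0, 2 | 2, 0 => decide (1 < L.count 1) || (decide (0 < L.count 1) && decide (0 < L.count 3))
  | 2, 2 => decide (1 < L.count 1 + L.count 3)
  | _, _ => decide (L ≠ [])

/-- The analogue of `metricJetVanishes` for the inverse metric. -/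
def invJetVanishes (L : List (Fin 4)) (i j : Fin 4) : Bool :=
  match i, j with
  | 1, 1 => metricJetVanishes L 0 0
  | 1, 3 | 3, 1 => metricJetVanishes L 0 2
  | 3, 3 => metricJetVanishes L 2 2
  | 0, 1 | 1, 0 | 2, 3 | 3, 2 => decide (L ≠ [])
  | _, _ => true

/-- The analogue of `metricJetVanishes` for the Christoffel symbols `Γ_{a,ij}` of the first kind. -/
def lowJetVanishes (L : List (Fin 4)) (a i j : Fin 4) : Bool :=
  metricJetVanishes (i :: L) j a && metricJetVanishes (j :: L) i a && metricJetVanishes (a :: L) i j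

/-- A sufficient condition for `g^{em} Γ_{e,ij} Γ_{m,kl}` to vanish. -/
def quadVanishes (e m i j k l : Fin 4) : Bool :=
  invJetVanishes [] e m || lowJetVanishes [] e i j || lowJetVanishes [] m k l

/-- A sufficient condition for `g^{em} Γ_{e,ij} Γ_{m,kl}` to be independent of `v`. -/
def quadConst (e m i j k l : Fin 4) : Bool :=
  invJetVanishes [1] e m && lowJetVanishes [1] e i j && lowJetVanishes [1] m k l

/-- A sufficient condition for `R_{abcd}` to vanish. -/
def riemannVanishes (a b c d : Fin 4) : Bool :=
  decide (a = b) || decide (c = d) ||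
    decide (0 ≤ boostWeight a + boostWeight b + boostWeight c + boostWeight d)

/-- A sufficient condition for `Γˡᵢⱼ` to vanish. -/
def christoffelVanishes (l i j : Fin 4) : Bool :=
  decide (∀ m, (invJetVanishes [] l m || lowJetVanishes [] m i j) = true)

/-- Repeated indices in an antisymmetric pair are excluded: antisymmetry of `R` handles them
separately. -/
theorem riemann_pattern : ∀ a b c d : Fin 4, a ≠ b → c ≠ d →
    0 ≤ boostWeight a + boostWeight b + boostWeight c + boostWeight d →
    lowJetVanishes [c] a d b = true ∧ lowJetVanishes [d] a c b = true ∧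
    ∀ e m, quadVanishes e m d a c b = true ∧ quadVanishes e m c a d b = true := by
  decide +kernel

theorem partialDeriv_riemann_pattern : ∀ a b c d : Fin 4, a ≠ b → c ≠ d →
    0 ≤ boostWeight a + boostWeight b + boostWeight c + boostWeight d + boostWeight 1 →
    lowJetVanishes [c, 1] a d b = true ∧ lowJetVanishes [d, 1] a c b = true ∧
    ∀ e m, (quadVanishes e m d a c b || quadConst e m d a c b) = true ∧
      (quadVanishes e m c a d b || quadConst e m c a d b) = true := by
  decide +kernel

/-- Every index has odd `b₁ + b₂`, so four indices never have weight `(0, -1)`. Hence for `m ≠ 1`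
the component of `R` already has nonnegative weight. Only `m = 1`, the derivative along `v`,
requires `partialDeriv_riemann_pattern`. -/
theorem covDeriv_riemann_pattern : ∀ a b c d m : Fin 4, a ≠ b → c ≠ d →
    0 ≤ boostWeight a + boostWeight b + boostWeight c + boostWeight d + boostWeight m →
    (m = 1 ∨ riemannVanishes a b c d = true) ∧
    ∀ l, (christoffelVanishes l m a || riemannVanishes l b c d) = true ∧
      (christoffelVanishes l m b || riemannVanishes a l c d) = true ∧
      (christoffelVanishes l m c || riemannVanishes a b l d) = true ∧
      (christoffelVanishes l m d || riemannVanishes a b c l) = true := by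
  decide +kernel

theorem sum_map_single_one (L : List (Fin 4)) :
    (L.map (![0, 1, 0, 0] : Fin 4 → ℤ)).sum = L.count 1 := by
  induction L with
  | nil => rfl
  | cons i L ih =>
    rw [List.map_cons, List.sum_cons, ih, List.count_cons]
    fin_cases i <;> simp [add_comm]

theorem sum_map_one_one (L : List (Fin 4)) :
    (L.map (![0, 1, 0, 1] : Fin 4 → ℤ)).sum = L.count 1 + L.count 3 := by
  induction L with
  | nil => rfl
  | cons i L ih =>
    rw [List.map_cons, List.sum_cons, ih, List.count_cons, List.count_cons]
    fin_cases i <;> simp <;> ring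

/-- With the bound `(1, 0)`, the lexicographic order leaves pure `y`-derivatives `(0, n)` free and
excludes two `v`-derivatives or one together with a `y`-derivative, which is the dependence of `W`.
-/
theorem sum_map_lex (L : List (Fin 4)) :
    (L.map (![0, toLex (1, 0), 0, toLex (0, 1)] : Fin 4 → ℤ ×ₗ ℤ)).sum
      = toLex ((L.count 1 : ℤ), (L.count 3 : ℤ)) := by
  induction L with
  | nil => rfl
  | cons i L ih =>
    rw [List.map_cons, List.sum_cons, ih, List.count_cons, List.count_cons]
    apply ofLex.injective
    fin_cases i <;> simp [add_comm]

theorem iterPartial_const {n : ℕ} {L : List (Fin n)} (hL : L ≠ []) (c : ℝ) (p : Fin n → ℝ) :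
    iterPartial L (fun _ => c) p = 0 := by
  cases L with
  | nil => exact absurd rfl hL
  | cons i L =>
    rw [iterPartial, show partialDeriv i (fun _ : Fin n → ℝ => c) = fun _ => 0 from
        funext (partialDeriv_const i c), iterPartial_zero]

variable {U : Set (Fin 4 → ℝ)} {H₁ H₂ W : (Fin 4 → ℝ) → ℝ} {p : Fin 4 → ℝ}

/-- The dependence of `H₁`, `H₂`, `W` on `v` and `y`: `H₁` is of degree one in `v`, `H₂` is of
degree one in `(v, y)`, and `W` is the sum of a `v`-linear function independent of `y` and a
function independent of `v`. -/
structure HasWalkerDegrees (U : Set (Fin 4 → ℝ)) (H₁ H₂ W : (Fin 4 → ℝ) → ℝ) : Prop where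
  left : HasWeightLE U (![0, 1, 0, 0] : Fin 4 → ℤ) 1 H₁
  right : HasWeightLE U (![0, 1, 0, 1] : Fin 4 → ℤ) 1 H₂
  mixed : HasWeightLE U (![0, toLex (1, 0), 0, toLex (0, 1)] : Fin 4 → ℤ ×ₗ ℤ) (toLex (1, 0)) W

theorem isSymm_walkerMetric (p : Fin 4 → ℝ) : (walkerMetric H₁ H₂ W p).IsSymm := by
  ext i j
  fin_cases i <;> fin_cases j <;> rfl

theorem isUnit_det_walkerMetric (p : Fin 4 → ℝ) :
    IsUnit (walkerMetric H₁ H₂ W p).det := by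
  have : walkerMetric H₁ H₂ W p *
      !![0, 1, 0, 0; 1, -2 * H₁ p, 0, -2 * W p; 0, 0, 0, 1; 0, -2 * W p, 1, -2 * H₂ p] = 1 := by
    ext i j
    fin_cases i <;> fin_cases j <;> simp [walkerMetric, Matrix.mul_apply, Fin.sum_univ_four]
  exact Matrix.isUnit_det_of_right_inverse this

namespace HasWalkerDegrees

theorem jet_left (h : HasWalkerDegrees U H₁ H₂ W) (hU : IsOpen U) {L : List (Fin 4)}
    (hL : metricJetVanishes L 0 0 = true) (c : ℝ) (hp : p ∈ U) :
    iterPartial L (fun q => c * H₁ q) p = 0 := by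
  refine (h.left.const_mul hU c).2 L ?_ p hp
  rw [sum_map_single_one]
  exact_mod_cast of_decide_eq_true hL

theorem jet_right (h : HasWalkerDegrees U H₁ H₂ W) (hU : IsOpen U) {L : List (Fin 4)}
    (hL : metricJetVanishes L 2 2 = true) (c : ℝ) (hp : p ∈ U) :
    iterPartial L (fun q => c * H₂ q) p = 0 := by
  refine (h.right.const_mul hU c).2 L ?_ p hp
  rw [sum_map_one_one]
  exact_mod_cast of_decide_eq_true hL

theorem jet_mixed (h : HasWalkerDegrees U H₁ H₂ W) (hU : IsOpen U) {L : List (Fin 4)}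
    (hL : metricJetVanishes L 0 2 = true) (c : ℝ) (hp : p ∈ U) :
    iterPartial L (fun q => c * W q) p = 0 := by
  refine (h.mixed.const_mul hU c).2 L ?_ p hp
  rw [sum_map_lex, Prod.Lex.lt_iff]
  have hL' : 1 < L.count 1 ∨ (0 < L.count 1 ∧ 0 < L.count 3) := by
    simpa [metricJetVanishes] using hL
  simp only [ofLex_toLex]
  omega

theorem jet_metric (h : HasWalkerDegrees U H₁ H₂ W) (hU : IsOpen U) {L : List (Fin 4)}
    {i j : Fin 4} (hL : metricJetVanishes L i j = true) (c : ℝ) (hp : p ∈ U) :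
    iterPartial L (fun q => c * walkerMetric H₁ H₂ W q i j) p = 0 := by
  fin_cases i <;> fin_cases j <;> simp [walkerMetric, ← mul_assoc] <;>
    first
    | exact h.jet_left hU hL _ hp
    | exact h.jet_right hU hL _ hp
    | exact h.jet_mixed hU hL _ hp
    | exact iterPartial_const (of_decide_eq_true hL) _ p

theorem jet_inv (h : HasWalkerDegrees U H₁ H₂ W) (hU : IsOpen U) {L : List (Fin 4)}
    {i j : Fin 4} (hL : invJetVanishes L i j = true) (hp : p ∈ U) :
    iterPartial L (fun q => (walkerMetric H₁ H₂ W q)⁻¹ i j) p = 0 := by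
  simp only [walkerMetric_inv]
  fin_cases i <;> fin_cases j <;>
    first
    | exact h.jet_left hU hL (-2) hp
    | exact h.jet_right hU hL (-2) hp
    | exact h.jet_mixed hU hL (-2) hp
    | exact congrFun (iterPartial_zero L) p
    | exact iterPartial_const (of_decide_eq_true hL) _ p

theorem contDiffOn_metric (h : HasWalkerDegrees U H₁ H₂ W) (i j : Fin 4) :
    ContDiffOn ℝ ∞ (fun q => walkerMetric H₁ H₂ W q i j) U :=
  (isNeutralMetricOn_walkerMetric h.left.1 h.right.1 h.mixed.1).1 i j

theorem contDiffOn_inv (h : HasWalkerDegrees U H₁ H₂ W) (i j : Fin 4) :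
    ContDiffOn ℝ ∞ (fun q => (walkerMetric H₁ H₂ W q)⁻¹ i j) U := by
  simp only [walkerMetric_inv]
  fin_cases i <;> fin_cases j <;>
    first
    | exact contDiffOn_const
    | exact contDiffOn_const.mul h.left.1
    | exact contDiffOn_const.mul h.right.1
    | exact contDiffOn_const.mul h.mixed.1

theorem contDiffOn_low (h : HasWalkerDegrees U H₁ H₂ W) (hU : IsOpen U) (a i j : Fin 4) :
    ContDiffOn ℝ ∞ (christoffelLow (walkerMetric H₁ H₂ W) a i j) U :=
  contDiffOn_christoffelLow hU h.contDiffOn_metric a i j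

theorem jet_low (h : HasWalkerDegrees U H₁ H₂ W) (hU : IsOpen U) {L : List (Fin 4)}
    {a i j : Fin 4} (hL : lowJetVanishes L a i j = true) (hp : p ∈ U) :
    iterPartial L (christoffelLow (walkerMetric H₁ H₂ W) a i j) p = 0 := by
  simp only [lowJetVanishes, Bool.and_eq_true] at hL
  obtain ⟨⟨h1, h2⟩, h3⟩ := hL
  have hd : ∀ k i j, ContDiffOn ℝ ∞ (partialDeriv k fun q => walkerMetric H₁ H₂ W q i j) U :=
    fun k i j => contDiffOn_partialDeriv hU (h.contDiffOn_metric i j) k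
  have aux : ∀ (c : ℝ) {k i j : Fin 4}, metricJetVanishes (k :: L) i j = true →
      iterPartial L (fun q => c * partialDeriv k (fun q => walkerMetric H₁ H₂ W q i j) q) p = 0 := by
    intro c k i j hk
    have e : Set.EqOn (fun q => c * partialDeriv k (fun q => walkerMetric H₁ H₂ W q i j) q)
        (partialDeriv k fun q => c * walkerMetric H₁ H₂ W q i j) U := fun q hq =>
      (partialDeriv_const_mul
        (differentiableAt_of_contDiffOn hU (h.contDiffOn_metric i j) hq) c k).symm
    rw [iterPartial_congr hU L e hp]
    exact h.jet_metric hU hk c hp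
  have e : christoffelLow (walkerMetric H₁ H₂ W) a i j = fun q =>
      ((1 / 2 : ℝ) * partialDeriv i (fun q => walkerMetric H₁ H₂ W q j a) q
        + (1 / 2 : ℝ) * partialDeriv j (fun q => walkerMetric H₁ H₂ W q i a) q)
        + (-1 / 2 : ℝ) * partialDeriv a (fun q => walkerMetric H₁ H₂ W q i j) q := by
    funext q
    rw [christoffelLow]
    ring
  have hc : ∀ (c : ℝ) k i j, ContDiffOn ℝ ∞
      (fun q => c * partialDeriv k (fun q => walkerMetric H₁ H₂ W q i j) q) U := fun c k i j =>
    contDiffOn_const.mul (hd k i j)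
  rw [e, iterPartial_add hU L ((hc _ _ _ _).add (hc _ _ _ _)) (hc _ _ _ _) hp,
    iterPartial_add hU L (hc _ _ _ _) (hc _ _ _ _) hp, aux _ h1, aux _ h2, aux _ h3]
  simp

theorem christoffel_eq_zero (h : HasWalkerDegrees U H₁ H₂ W) (hU : IsOpen U) {l i j : Fin 4}
    (hl : christoffelVanishes l i j = true) (hp : p ∈ U) :
    christoffel (walkerMetric H₁ H₂ W) l i j p = 0 := by
  rw [christoffel_eq_sum]
  refine Finset.sum_eq_zero fun m _ => ?_
  have hm := of_decide_eq_true hl m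
  rcases Bool.or_eq_true _ _ ▸ hm with h1 | h1
  · rw [show (walkerMetric H₁ H₂ W p)⁻¹ l m = 0 from h.jet_inv hU h1 hp, zero_mul]
  · rw [show christoffelLow (walkerMetric H₁ H₂ W) m i j p = 0 from h.jet_low hU h1 hp, mul_zero]

theorem quad_eq_zero (h : HasWalkerDegrees U H₁ H₂ W) (hU : IsOpen U) {e m i j k l : Fin 4}
    (hq : quadVanishes e m i j k l = true) (hp : p ∈ U) :
    (walkerMetric H₁ H₂ W p)⁻¹ e m * (christoffelLow (walkerMetric H₁ H₂ W) e i j p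
      * christoffelLow (walkerMetric H₁ H₂ W) m k l p) = 0 := by
  simp only [quadVanishes, Bool.or_eq_true] at hq
  rcases hq with (h1 | h1) | h1
  · rw [show (walkerMetric H₁ H₂ W p)⁻¹ e m = 0 from h.jet_inv hU h1 hp, zero_mul]
  · rw [show christoffelLow (walkerMetric H₁ H₂ W) e i j p = 0 from h.jet_low hU h1 hp, zero_mul,
      mul_zero]
  · rw [show christoffelLow (walkerMetric H₁ H₂ W) m k l p = 0 from h.jet_low hU h1 hp, mul_zero,
      mul_zero]

theorem partialDeriv_quad_eq_zero (h : HasWalkerDegrees U H₁ H₂ W) (hU : IsOpen U)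
    {e m i j k l : Fin 4} (hq : (quadVanishes e m i j k l || quadConst e m i j k l) = true)
    (hp : p ∈ U) :
    partialDeriv 1 (fun q => (walkerMetric H₁ H₂ W q)⁻¹ e m
      * (christoffelLow (walkerMetric H₁ H₂ W) e i j q
        * christoffelLow (walkerMetric H₁ H₂ W) m k l q)) p = 0 := by
  rcases Bool.or_eq_true _ _ ▸ hq with h0 | h0
  · exact (partialDeriv_congr hU (g := fun _ => 0) (fun q hq => h.quad_eq_zero hU h0 hq) 1
      hp).trans (partialDeriv_const _ _ _)
  · simp only [quadConst, Bool.and_eq_true] at h0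
    obtain ⟨⟨h1, h2⟩, h3⟩ := h0
    have d1 := differentiableAt_of_contDiffOn hU (h.contDiffOn_inv e m) hp
    have d2 := differentiableAt_of_contDiffOn hU (h.contDiffOn_low hU e i j) hp
    have d3 := differentiableAt_of_contDiffOn hU (h.contDiffOn_low hU m k l) hp
    rw [partialDeriv_mul d1 (d2.fun_mul d3), partialDeriv_mul d2 d3,
      show partialDeriv 1 (fun q => (walkerMetric H₁ H₂ W q)⁻¹ e m) p = 0 from h.jet_inv hU h1 hp,
      show partialDeriv 1 (christoffelLow (walkerMetric H₁ H₂ W) e i j) p = 0 from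
        h.jet_low hU h2 hp,
      show partialDeriv 1 (christoffelLow (walkerMetric H₁ H₂ W) m k l) p = 0 from
        h.jet_low hU h3 hp]
    simp

theorem riemann_swap_left (h : HasWalkerDegrees U H₁ H₂ W) (hU : IsOpen U) (I : Fin 4 → Fin 4)
    (hp : p ∈ U) :
    riemann (walkerMetric H₁ H₂ W) (I ∘ Equiv.swap 0 1) p = -riemann (walkerMetric H₁ H₂ W) I p :=
  Walker.riemann_swap_left hU isSymm_walkerMetric isUnit_det_walkerMetric h.contDiffOn_metric
    h.contDiffOn_inv hp I

theorem riemann_eq_zero (h : HasWalkerDegrees U H₁ H₂ W) (hU : IsOpen U) {I : Fin 4 → Fin 4}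
    (hI : riemannVanishes (I 0) (I 1) (I 2) (I 3) = true) (hp : p ∈ U) :
    riemann (walkerMetric H₁ H₂ W) I p = 0 := by
  by_cases h01 : I 0 = I 1
  · have := h.riemann_swap_left hU I hp
    rw [show I ∘ Equiv.swap 0 1 = I from funext fun s => by
      fin_cases s
      exacts [h01.symm, h01, rfl, rfl]] at this
    linarith
  by_cases h23 : I 2 = I 3
  · have := riemann_swap_right (g := walkerMetric H₁ H₂ W) I p
    rw [show I ∘ Equiv.swap 2 3 = I from funext fun s => by
      fin_cases s
      exacts [rfl, rfl, h23.symm, h23]] at this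
    linarith
  have hw : 0 ≤ boostWeight (I 0) + boostWeight (I 1) + boostWeight (I 2) + boostWeight (I 3) := by
    simpa [riemannVanishes, h01, h23] using hI
  obtain ⟨h1, h2, h3⟩ := riemann_pattern _ _ _ _ h01 h23 hw
  have e1 : partialDeriv (I 2) (christoffelLow (walkerMetric H₁ H₂ W) (I 0) (I 3) (I 1)) p = 0 :=
    h.jet_low hU h1 hp
  have e2 : partialDeriv (I 3) (christoffelLow (walkerMetric H₁ H₂ W) (I 0) (I 2) (I 1)) p = 0 :=
    h.jet_low hU h2 hp
  rw [Walker.riemann_eq hU isSymm_walkerMetric isUnit_det_walkerMetric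
      h.contDiffOn_metric h.contDiffOn_inv hp I, e1, e2, sub_self, zero_add]
  refine Finset.sum_eq_zero fun e _ => Finset.sum_eq_zero fun m _ => ?_
  rw [h.quad_eq_zero hU (h3 e m).1 hp, h.quad_eq_zero hU (h3 e m).2 hp, sub_self]

theorem partialDeriv_riemann_eq_zero (h : HasWalkerDegrees U H₁ H₂ W) (hU : IsOpen U)
    {I : Fin 4 → Fin 4} (h01 : I 0 ≠ I 1) (h23 : I 2 ≠ I 3)
    (hw : 0 ≤ boostWeight (I 0) + boostWeight (I 1) + boostWeight (I 2) + boostWeight (I 3)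
      + boostWeight 1) (hp : p ∈ U) :
    partialDeriv 1 (riemann (walkerMetric H₁ H₂ W) I) p = 0 := by
  obtain ⟨h1, h2, h3⟩ := partialDeriv_riemann_pattern _ _ _ _ h01 h23 hw
  have dl : ∀ k a i j, DifferentiableAt ℝ
      (partialDeriv k (christoffelLow (walkerMetric H₁ H₂ W) a i j)) p := fun k a i j =>
    differentiableAt_of_contDiffOn hU (contDiffOn_partialDeriv hU (h.contDiffOn_low hU a i j) k) hp
  have dq : ∀ e m i j k l, DifferentiableAt ℝ (fun q => (walkerMetric H₁ H₂ W q)⁻¹ e m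
      * (christoffelLow (walkerMetric H₁ H₂ W) e i j q
        * christoffelLow (walkerMetric H₁ H₂ W) m k l q)) p := fun e m i j k l =>
    differentiableAt_of_contDiffOn hU
      ((h.contDiffOn_inv e m).mul ((h.contDiffOn_low hU e i j).mul (h.contDiffOn_low hU m k l))) hp
  rw [partialDeriv_congr hU (fun q hq => Walker.riemann_eq hU isSymm_walkerMetric isUnit_det_walkerMetric
      h.contDiffOn_metric h.contDiffOn_inv hq I) 1 hp,
    partialDeriv_add ((dl _ _ _ _).fun_sub (dl _ _ _ _)) (DifferentiableAt.fun_sum fun e _ =>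
      DifferentiableAt.fun_sum fun m _ => (dq _ _ _ _ _ _).fun_sub (dq _ _ _ _ _ _)),
    partialDeriv_sub (dl _ _ _ _) (dl _ _ _ _),
    partialDeriv_sum fun e _ =>
      DifferentiableAt.fun_sum fun m _ => (dq _ _ _ _ _ _).fun_sub (dq _ _ _ _ _ _)]
  have e1 : partialDeriv 1 (partialDeriv (I 2)
      (christoffelLow (walkerMetric H₁ H₂ W) (I 0) (I 3) (I 1))) p = 0 := h.jet_low hU h1 hp
  have e2 : partialDeriv 1 (partialDeriv (I 3)
      (christoffelLow (walkerMetric H₁ H₂ W) (I 0) (I 2) (I 1))) p = 0 := h.jet_low hU h2 hp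
  rw [e1, e2, sub_self, zero_add]
  refine Finset.sum_eq_zero fun e _ => ?_
  rw [partialDeriv_sum fun m _ => (dq _ _ _ _ _ _).fun_sub (dq _ _ _ _ _ _)]
  refine Finset.sum_eq_zero fun m _ => ?_
  rw [partialDeriv_sub (dq _ _ _ _ _ _) (dq _ _ _ _ _ _),
    h.partialDeriv_quad_eq_zero hU (h3 e m).1 hp, h.partialDeriv_quad_eq_zero hU (h3 e m).2 hp,
    sub_self]

theorem lexVanishes_riemann (h : HasWalkerDegrees U H₁ H₂ W) (hU : IsOpen U) :
    LexVanishes U (riemann (walkerMetric H₁ H₂ W)) := by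
  intro I hI p hp
  rw [Fin.sum_univ_four] at hI
  exact h.riemann_eq_zero hU (by simp [riemannVanishes, hI]) hp

theorem lexVanishes_covDeriv_riemann (h : HasWalkerDegrees U H₁ H₂ W) (hU : IsOpen U) :
    LexVanishes U (covDeriv (walkerMetric H₁ H₂ W) (riemann (walkerMetric H₁ H₂ W))) := by
  intro I hI p hp
  by_cases h01 : I 0 = I 1
  · refine covDeriv_eq_zero_of_swap hU (Equiv.swap 0 1)
      (fun J q hq => h.riemann_swap_left hU J hq) (fun s => ?_) hp
    fin_cases s
    exacts [h01.symm, h01, rfl, rfl]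
  by_cases h23 : I 2 = I 3
  · refine covDeriv_eq_zero_of_swap hU (Equiv.swap 2 3)
      (fun J q hq => riemann_swap_right J q) (fun s => ?_) hp
    fin_cases s
    exacts [rfl, rfl, h23.symm, h23]
  rw [Fin.sum_univ_five] at hI
  obtain ⟨h1, h2⟩ := covDeriv_riemann_pattern _ _ _ _ _ h01 h23 hI
  have e1 : partialDeriv (I (Fin.last 4))
      (riemann (walkerMetric H₁ H₂ W) fun s => I s.castSucc) p = 0 := by
    -- For directions other than `v` the differentiated component vanishes throughout `U`.
    by_cases hm : I 4 = 1
    · rw [show I (Fin.last 4) = 1 from hm]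
      exact h.partialDeriv_riemann_eq_zero hU h01 h23 (by rw [hm] at hI; exact hI) hp
    · exact (partialDeriv_congr hU (g := fun _ => 0)
        (fun q hq => h.riemann_eq_zero hU (h1.resolve_left hm) hq) _ hp).trans
        (partialDeriv_const _ _ _)
  rw [covDeriv, e1, zero_sub, neg_eq_zero]
  refine Finset.sum_eq_zero fun s _ => Finset.sum_eq_zero fun l _ => ?_
  have aux : ∀ i : Fin 4, ∀ J : Fin 4 → Fin 4,
      (christoffelVanishes l (I 4) i || riemannVanishes (J 0) (J 1) (J 2) (J 3)) = true →
      christoffel (walkerMetric H₁ H₂ W) l (I 4) i p * riemann (walkerMetric H₁ H₂ W) J p = 0 := by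
    intro i J hJ
    rcases Bool.or_eq_true _ _ ▸ hJ with hJ | hJ
    · rw [h.christoffel_eq_zero hU hJ hp, zero_mul]
    · rw [h.riemann_eq_zero hU hJ hp, mul_zero]
  fin_cases s
  · exact aux _ _ (h2 l).1
  · exact aux _ _ (h2 l).2.1
  · exact aux _ _ (h2 l).2.2.1
  · exact aux _ _ (h2 l).2.2.2

end HasWalkerDegrees

end VanishingPatterns

/-! ### Weights of the coefficient functions -/

section Coefficients

theorem sum_map_nonpos {ι Γ : Type*} [AddCommGroup Γ] [LinearOrder Γ] [IsOrderedAddMonoid Γ]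
    {b : ι → Γ} {L : List ι} (h : ∀ i ∈ L, b i ≤ 0) : (L.map b).sum ≤ 0 := by
  induction L with
  | nil => simp
  | cons i L ih =>
    rw [List.map_cons, List.sum_cons]
    exact add_nonpos (h i (by simp)) (ih fun j hj => h j (by simp [hj]))

theorem ofLex_sum_map_fst {ι : Type*} (b : ι → ℤ ×ₗ ℤ) (L : List ι) :
    (ofLex (L.map b).sum).1 = (L.map fun i => (ofLex (b i)).1).sum := by
  induction L with
  | nil => rfl
  | cons i L ih => rw [List.map_cons, List.sum_cons, List.map_cons, List.sum_cons, ← ih]; rfl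

variable {U : Set (Fin 4 → ℝ)} {Γ : Type*} [AddCommGroup Γ] [LinearOrder Γ] [IsOrderedAddMonoid Γ]

theorem HasWeightLE.of_uxy {F : ℝ → ℝ → ℝ → ℝ} {b : Fin 4 → Γ} {w : Γ}
    (hF : ContDiffOn ℝ ∞ (fun p : Fin 4 → ℝ => F (p 0) (p 2) (p 3)) U)
    (hw : ∀ L : List (Fin 4), (∀ i ∈ L, i ≠ 1) → (L.map b).sum ≤ w) :
    HasWeightLE U b w (fun p : Fin 4 → ℝ => F (p 0) (p 2) (p 3)) := by
  refine HasWeightLE.of_translate hF {1} ?_ hw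
  rintro i rfl p t
  simp

theorem HasWeightLE.of_ux {F : ℝ → ℝ → ℝ} {b : Fin 4 → Γ}
    (hF : ContDiffOn ℝ ∞ (fun p : Fin 4 → ℝ => F (p 0) (p 2)) U) (h0 : b 0 ≤ 0) (h2 : b 2 ≤ 0) :
    HasWeightLE U b 0 (fun p : Fin 4 → ℝ => F (p 0) (p 2)) := by
  refine HasWeightLE.of_translate hF {1, 3} ?_ fun L hL => sum_map_nonpos fun i hi => ?_
  · rintro i (rfl | rfl) p t <;> simp
  · have := hL i hi
    fin_cases i
    · exact h0
    · simp at this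
    · exact h2
    · simp at this

/-- Derivatives avoiding `v` never raise the first entry of the weight above zero, so arbitrary
dependence on `y` is harmless under a bound with positive first entry. -/
theorem HasWeightLE.of_uxy_lex {F : ℝ → ℝ → ℝ → ℝ} {b : Fin 4 → ℤ ×ₗ ℤ} {w : ℤ ×ₗ ℤ}
    (hF : ContDiffOn ℝ ∞ (fun p : Fin 4 → ℝ => F (p 0) (p 2) (p 3)) U)
    (hb : ∀ i, i ≠ 1 → (ofLex (b i)).1 ≤ 0) (hw : 0 < (ofLex w).1) :
    HasWeightLE U b w (fun p : Fin 4 → ℝ => F (p 0) (p 2) (p 3)) := by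
  refine HasWeightLE.of_uxy hF fun L hL => le_of_lt (Prod.Lex.lt_iff.2 (Or.inl ?_))
  rw [ofLex_sum_map_fst]
  exact (sum_map_nonpos fun i hi => hb i (hL i hi)).trans_lt hw

variable {H₁₁ H₁₀ W₀ : ℝ → ℝ → ℝ → ℝ} {H₂₁₀ H₂₀₁ H₂₀ W₁ : ℝ → ℝ → ℝ}

theorem hasWalkerDegrees (hU : IsOpen U)
    (hH₁₁ : ContDiffOn ℝ ∞ (fun p : Fin 4 → ℝ => H₁₁ (p 0) (p 2) (p 3)) U)
    (hH₁₀ : ContDiffOn ℝ ∞ (fun p : Fin 4 → ℝ => H₁₀ (p 0) (p 2) (p 3)) U)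
    (hH₂₁₀ : ContDiffOn ℝ ∞ (fun p : Fin 4 → ℝ => H₂₁₀ (p 0) (p 2)) U)
    (hH₂₀₁ : ContDiffOn ℝ ∞ (fun p : Fin 4 → ℝ => H₂₀₁ (p 0) (p 2)) U)
    (hH₂₀ : ContDiffOn ℝ ∞ (fun p : Fin 4 → ℝ => H₂₀ (p 0) (p 2)) U)
    (hW₁ : ContDiffOn ℝ ∞ (fun p : Fin 4 → ℝ => W₁ (p 0) (p 2)) U)
    (hW₀ : ContDiffOn ℝ ∞ (fun p : Fin 4 → ℝ => W₀ (p 0) (p 2) (p 3)) U) :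
    HasWalkerDegrees U (fun p => p 1 * H₁₁ (p 0) (p 2) (p 3) + H₁₀ (p 0) (p 2) (p 3))
      (fun p => p 1 * H₂₁₀ (p 0) (p 2) + p 3 * H₂₀₁ (p 0) (p 2) + H₂₀ (p 0) (p 2))
      (fun p => p 1 * W₁ (p 0) (p 2) + W₀ (p 0) (p 2) (p 3)) where
  left := by
    have h : ∀ L : List (Fin 4), (∀ i ∈ L, i ≠ 1) →
        (L.map (![0, 1, 0, 0] : Fin 4 → ℤ)).sum ≤ 0 := fun L hL => sum_map_nonpos fun i hi => by
      have := hL i hi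
      fin_cases i <;> simp_all
    exact ((((HasWeightLE.coord 1 (by simp)).mul hU (HasWeightLE.of_uxy hH₁₁ h)).mono
      (by simp)).add hU ((HasWeightLE.of_uxy hH₁₀ h).mono (by simp)))
  right := by
    have h : ∀ {F : ℝ → ℝ → ℝ}, ContDiffOn ℝ ∞ (fun p : Fin 4 → ℝ => F (p 0) (p 2)) U →
        HasWeightLE U (![0, 1, 0, 1] : Fin 4 → ℤ) 0 (fun p : Fin 4 → ℝ => F (p 0) (p 2)) :=
      fun hF => HasWeightLE.of_ux hF (by simp) (by simp)
    exact ((((HasWeightLE.coord 1 (by simp)).mul hU (h hH₂₁₀)).mono (by simp)).add hU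
      (((HasWeightLE.coord 3 (by simp)).mul hU (h hH₂₀₁)).mono (by simp))).add hU
      ((h hH₂₀).mono (by simp))
  mixed :=
    (((HasWeightLE.coord 1 (by decide)).mul hU (HasWeightLE.of_ux hW₁ le_rfl le_rfl)).mono
      (by decide)).add hU (HasWeightLE.of_uxy_lex hW₀ (by decide) (by decide))

end Coefficients

end Walker

/-! ### The two cases of the theorem -/

theorem mainTheorem3
    (U : Set (Fin 4 → ℝ)) (hU : IsOpen U)
    (H₁₁ H₁₀ W₀ : ℝ → ℝ → ℝ → ℝ) (H₂₁₀ H₂₀₁ H₂₀ W₁ : ℝ → ℝ → ℝ)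
    (hH₁₁ : ContDiffOn ℝ ∞ (fun p : Fin 4 → ℝ => H₁₁ (p 0) (p 2) (p 3)) U)
    (hH₁₀ : ContDiffOn ℝ ∞ (fun p : Fin 4 → ℝ => H₁₀ (p 0) (p 2) (p 3)) U)
    (hH₂₁₀ : ContDiffOn ℝ ∞ (fun p : Fin 4 → ℝ => H₂₁₀ (p 0) (p 2)) U)
    (hH₂₀₁ : ContDiffOn ℝ ∞ (fun p : Fin 4 → ℝ => H₂₀₁ (p 0) (p 2)) U)
    (hH₂₀ : ContDiffOn ℝ ∞ (fun p : Fin 4 → ℝ => H₂₀ (p 0) (p 2)) U)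
    (hW₁ : ContDiffOn ℝ ∞ (fun p : Fin 4 → ℝ => W₁ (p 0) (p 2)) U)
    (hW₀ : ContDiffOn ℝ ∞ (fun p : Fin 4 → ℝ => W₀ (p 0) (p 2) (p 3)) U)
    (H₁ H₂ W : (Fin 4 → ℝ) → ℝ)
    (hH₁ : H₁ = fun p => p 1 * H₁₁ (p 0) (p 2) (p 3) + H₁₀ (p 0) (p 2) (p 3))
    (hH₂ : H₂ = fun p => p 1 * H₂₁₀ (p 0) (p 2) + p 3 * H₂₀₁ (p 0) (p 2) + H₂₀ (p 0) (p 2))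
    (hW : W = fun p => p 1 * W₁ (p 0) (p 2) + W₀ (p 0) (p 2) (p 3)) :
    Walker.IsNeutralMetricOn (Walker.walkerMetric H₁ H₂ W) U ∧
    ((∃ p ∈ U, H₂₁₀ (p 0) (p 2) ≠ 0) →
      Walker.IsVSIOrder (Walker.walkerMetric H₁ H₂ W) U 1 ∧
      ∀ k ≤ 1, Walker.NProperty (Walker.nullFrame H₁ H₂ W) U
        (Walker.nablaRiemann (Walker.walkerMetric H₁ H₂ W) k)) ∧
    ((∀ p ∈ U, H₂₁₀ (p 0) (p 2) = 0) →
      Walker.IsVSI (Walker.walkerMetric H₁ H₂ W) U ∧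
      ∀ k, Walker.NProperty (Walker.nullFrame H₁ H₂ W) U
        (Walker.nablaRiemann (Walker.walkerMetric H₁ H₂ W) k)) := by
  open Walker in
  have hdeg : HasWalkerDegrees U H₁ H₂ W := by
    subst hH₁ hH₂ hW
    exact hasWalkerDegrees hU hH₁₁ hH₁₀ hH₂₁₀ hH₂₀₁ hH₂₀ hW₁ hW₀
  refine ⟨isNeutralMetricOn_walkerMetric hdeg.left.1 hdeg.right.1 hdeg.mixed.1, fun _ => ?_,
    fun h0 => ?_⟩
  · have hv : ∀ k ≤ 1, LexVanishes U (nablaRiemann (walkerMetric H₁ H₂ W) k) := by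
      intro k hk
      interval_cases k
      · exact hdeg.lexVanishes_riemann hU
      · exact hdeg.lexVanishes_covDeriv_riemann hU
    exact ⟨isVSIOrder_of_lexVanishes hv, fun k hk => (hv k hk).nProperty⟩
  · have hb : ∀ i : Fin 4, i ≠ 1 → (ofLex (boostWeight i)).1 ≤ 0 := by decide
    have h₁ : HasWeightLE U boostWeight (toLex (2, -1)) H₁ := by
      rw [hH₁]
      -- The bound `(1, -1)` is what remains of `(2, -1)` after the weight `(1, 0)` of the factor
      -- `v`.
      exact (((HasWeightLE.coord 1 (by decide)).mul hU (HasWeightLE.of_uxy_lex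
        (w := toLex (1, -1)) hH₁₁ hb (by decide))).mono (by decide)).add hU
        (HasWeightLE.of_uxy_lex hH₁₀ hb (by decide))
    have h₂ : HasWeightLE U boostWeight (toLex (0, 1)) H₂ := by
      -- This is where `H₂₁₀ = 0` enters: on `U` the `v`-term of `H₂` drops out, leaving the
      -- `y`-linear part of weight `(0, 1)`.
      refine HasWeightLE.congr hU
        (f := fun p => p 3 * H₂₀₁ (p 0) (p 2) + H₂₀ (p 0) (p 2)) ?_ fun p hp => ?_
      · exact (((HasWeightLE.coord 3 (by decide)).mul hU
          (HasWeightLE.of_ux hH₂₀₁ (by decide) (by decide))).mono (by decide)).add hU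
          ((HasWeightLE.of_ux hH₂₀ (by decide) (by decide)).mono (by decide))
      · simp [hH₂, h0 p hp]
    have h₃ : HasWeightLE U boostWeight (toLex (1, 0)) W := by
      rw [hW]
      exact (((HasWeightLE.coord 1 (by decide)).mul hU
        (HasWeightLE.of_ux hW₁ (by decide) (by decide))).mono (by decide)).add hU
        (HasWeightLE.of_uxy_lex hW₀ hb (by decide))
    have hv := lexVanishes_nablaRiemann hU h₁ h₂ h₃
    exact ⟨fun N => isVSIOrder_of_lexVanishes fun k _ => hv k, fun k => (hv k).nProperty⟩
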